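/- For $n\ge 0$ let $K_n=\mathbb{C}(x_1,\dots,x_n,y_1,\dots,y_n)$ be the Poisson field with bracket $\{f,g\}=\sum_i\left(\frac{\partial f}{\partial x_i}\frac{\partial g}{\partial y_i}-\frac{\partial f}{\partial y_i}\frac{\partial g}{\partial x_i}\right)$, the field of rational functions on $(\mathbb{C}^2)^n$ with coordinates $(x_i,y_i)$; write $x=x_1$, $y=y_1$ for $n=1$. Let $\Gamma$ be a finite subgroup of $SL_2(\mathbb{C})$ of order $m$, acting naturally on $\mathbb{C}^2$, and let $G=\Gamma\wr S_n=\Gamma^n\rtimes S_n$ act naturally on $(\mathbb{C}^2)^n$. These groups act on $K_1$ and $K_n$ by Poisson automorphisms, $(gf)(p)=f(g^{-1}p)$, so that $K_1^\Gamma$ and $K_n^G$ are Poisson fields. Put $t=y/x$. Call $(u,v)$, with $u,v\in K_1^\Gamma$, a canonical pair if there is an isomorphism of Poisson fields $K_1^\Gamma\to K_1$ over $\mathbb{C}$ with $u\mapsto x$, $v\mapsto y$. Call $(u,v)$ an explicit pair if it has one of the following two forms. (E1) $u=\dfrac{\ell_1}{m\,\ell_2^{\,m-1}}$ and $v=\ell_2^{\,m}$,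 where $\ell_1,\ell_2\in\mathbb{C}x+\mathbb{C}y$ satisfy $\{\ell_1,\ell_2\}=1$ and each of them is mapped by every element of $\Gamma$ to a scalar multiple of itself. (E2) $-1\in\Gamma$, $v$ is a generator of $\mathbb{C}(t)^\Gamma$, that is $\mathbb{C}(v)=\mathbb{C}(t)\cap K_1^\Gamma$, and $u=\dfrac{x^2}{2\,dv/dt}$, where $dv/dt=x\,\partial v/\partial y$. Then the following hold. (1) For every $a\in\mathbb{C}$ such that $g_{22}\ne a\,g_{12}$ for all $g=(g_{ij})\in\Gamma$ (this excludes only finitely many $a$), the product $v=\prod_{s\in\Gamma\cdot t}(s-a)$ over the $\Gamma$-orbit of $t$ generates $\mathbb{C}(t)^\Gamma$. (2) Explicit pairs exist for $\Gamma$, and every explicit pair is a canonical pair. (3) Let $(u,v)$ be any canonical pair, let $u_i,v_i\in K_n$ be its copies in the $i$-th factor (obtained by $x\mapsto x_i$, $y\mapsto y_i$), let $e_1,\dots,e_n$ be the elementary symmetric polynomials in $z_1,\dots,z_n$, and let $M$ be the $n\times n$ matrix over $K_n$ with entries $M_{ij}=\frac{\partial e_j}{\partial z_i}(v_1,\dots,v_n)$.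 Then $\det M\ne 0$, and with $$V_i=e_i(v_1,\dots,v_n),\qquad U_i=\sum_{j=1}^n (M^{-1})_{ij}\,u_j\qquad(i=1,\dots,n)$$ the elements $U_i,V_i$ lie in $K_n^G$ and there is an isomorphism of Poisson fields $K_n^G\cong K_n$ over $\mathbb{C}$ with $U_i\mapsto x_i$ and $V_i\mapsto y_i$ for all $i$. In particular $K_n^G\cong K_n$ as Poisson fields, by the explicit isomorphism that (3) gives for an explicit pair $(u,v)$. -/

import Mathlib

noncomputable section

namespace PoissonNoether

/-! ### Poisson algebras -/

/-- A Poisson bracket on a commutative `R`-algebra `A`. -/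
class PoissonAlgebra (R A : Type*) [CommRing R] [CommRing A] [Algebra R A] where
  pb : A → A → A
  pb_add : ∀ f g h, pb f (g + h) = pb f g + pb f h
  pb_smul : ∀ (c : R) f g, pb f (c • g) = c • pb f g
  pb_self : ∀ f, pb f f = 0
  pb_skew : ∀ f g, pb f g = -pb g f
  pb_mul : ∀ f g h, pb f (g * h) = g * pb f h + h * pb f g
  pb_jacobi : ∀ f g h, pb f (pb g h) + pb g (pb h f) + pb h (pb f g) = 0

/-- Isomorphisms of Poisson algebras. -/
structure PoissonEquiv (R A B : Type*) [CommRing R] [CommRing A] [CommRing B] [Algebra R A]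
    [Algebra R B] [PoissonAlgebra R A] [PoissonAlgebra R B] extends A ≃ₐ[R] B where
  map_pb : ∀ f g : A, toAlgEquiv (PoissonAlgebra.pb R f g) =
    PoissonAlgebra.pb R (toAlgEquiv f) (toAlgEquiv g)

/-! ### Derivations of fraction fields -/

section FracDeriv

theorem fracDeriv_aux {A : Type*} [CommRing A] [Algebra ℂ A] (D : Derivation ℂ A A) {F : Type*} [Field F] [Algebra A F]
    [IsFractionRing A F] (a b c d : A) (hb : b ≠ 0) (hd : d ≠ 0)
    (h : algebraMap A F a / algebraMap A F b = algebraMap A F c / algebraMap A F d) :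
    (algebraMap A F (D a) * algebraMap A F b - algebraMap A F a * algebraMap A F (D b)) /
        algebraMap A F b ^ 2 =
      (algebraMap A F (D c) * algebraMap A F d - algebraMap A F c * algebraMap A F (D d)) /
        algebraMap A F d ^ 2 := by
  have hinj : Function.Injective (algebraMap A F) := IsFractionRing.injective A F
  have hb' : algebraMap A F b ≠ 0 := by simpa using hinj.ne hb
  have hd' : algebraMap A F d ≠ 0 := by simpa using hinj.ne hd
  rw [div_eq_div_iff hb' hd'] at h
  have h1 : a * d = c * b := hinj (by simpa using h)
  have h2 := congrArg (algebraMap A F) (congrArg D h1)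
  simp only [Derivation.leibniz, smul_eq_mul, map_add, map_mul] at h2
  rw [div_eq_div_iff (pow_ne_zero 2 hb') (pow_ne_zero 2 hd')]
  linear_combination (algebraMap A F b * algebraMap A F d) * h2 -
    (algebraMap A F b * algebraMap A F (D d) + algebraMap A F d * algebraMap A F (D b)) * h

variable {A : Type*} [CommRing A] [IsDomain A] [Algebra ℂ A]

/-- The extension of a derivation to the field of fractions by the quotient rule
`D (a / b) = (D a * b - a * D b) / b ^ 2`. -/
def fracDerivFun (D : Derivation ℂ A A) (f : FractionRing A) : FractionRing A :=
  let a := (IsLocalization.sec (nonZeroDivisors A) f).1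
  let b := (IsLocalization.sec (nonZeroDivisors A) f).2.1
  (algebraMap A (FractionRing A) (D a) * algebraMap A _ b -
    algebraMap A _ a * algebraMap A _ (D b)) / algebraMap A _ b ^ 2

theorem fracDerivFun_div (D : Derivation ℂ A A) (a b : A) (hb : b ≠ 0) :
    fracDerivFun D (algebraMap A _ a / algebraMap A _ b) =
      (algebraMap A (FractionRing A) (D a) * algebraMap A _ b -
        algebraMap A _ a * algebraMap A _ (D b)) / algebraMap A _ b ^ 2 := by
  unfold fracDerivFun
  apply fracDeriv_aux D _ _ _ _ (nonZeroDivisors.coe_ne_zero _) hb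
  rw [← IsFractionRing.mk'_eq_div, IsLocalization.mk'_sec]

/-- The derivation of the field of fractions extending a given derivation. -/
def fracDeriv (D : Derivation ℂ A A) : Derivation ℂ (FractionRing A) (FractionRing A) :=
  Derivation.mk'
    { toFun := fracDerivFun D
      map_add' := by
        intro f g
        obtain ⟨a, b, hb, rfl⟩ := IsFractionRing.div_surjective A f
        obtain ⟨c, d, hd, rfl⟩ := IsFractionRing.div_surjective A g
        have hb := nonZeroDivisors.ne_zero hb
        have hd := nonZeroDivisors.ne_zero hd
        have hb' : algebraMap A (FractionRing A) b ≠ 0 := by simpa using hb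
        have hd' : algebraMap A (FractionRing A) d ≠ 0 := by simpa using hd
        rw [div_add_div _ _ hb' hd', ← map_mul, ← map_mul, ← map_mul, ← map_add,
          fracDerivFun_div D _ _ (mul_ne_zero hb hd), fracDerivFun_div D _ _ hb,
          fracDerivFun_div D _ _ hd]
        simp only [Derivation.leibniz, smul_eq_mul, map_add, map_mul]
        field_simp
        ring
      map_smul' := by
        intro r f
        obtain ⟨a, b, hb, rfl⟩ := IsFractionRing.div_surjective A f
        have hb := nonZeroDivisors.ne_zero hb
        have e : r • (algebraMap A (FractionRing A) a / algebraMap A _ b) =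
            algebraMap A _ (r • a) / algebraMap A _ b := by
          rw [Algebra.smul_def, Algebra.smul_def, map_mul,
            ← IsScalarTower.algebraMap_apply ℂ A (FractionRing A), mul_div_assoc]
        rw [e, fracDerivFun_div D _ _ hb, fracDerivFun_div D _ _ hb, RingHom.id_apply,
          Derivation.map_smul]
        simp only [Algebra.smul_def, map_mul,
          ← IsScalarTower.algebraMap_apply ℂ A (FractionRing A)]
        ring }
    (by
      intro f g
      obtain ⟨a, b, hb, rfl⟩ := IsFractionRing.div_surjective A f
      obtain ⟨c, d, hd, rfl⟩ := IsFractionRing.div_surjective A g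
      have hb := nonZeroDivisors.ne_zero hb
      have hd := nonZeroDivisors.ne_zero hd
      have hb' : algebraMap A (FractionRing A) b ≠ 0 := by simpa using hb
      have hd' : algebraMap A (FractionRing A) d ≠ 0 := by simpa using hd
      change fracDerivFun D _ = _ • fracDerivFun D _ + _ • fracDerivFun D _
      rw [div_mul_div_comm, ← map_mul, ← map_mul,
        fracDerivFun_div D _ _ (mul_ne_zero hb hd), fracDerivFun_div D _ _ hb,
        fracDerivFun_div D _ _ hd]
      simp only [Derivation.leibniz, smul_eq_mul, map_add, map_mul]
      field_simp
      ring)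

theorem fracDeriv_algebraMap (D : Derivation ℂ A A) (a : A) :
    fracDeriv D (algebraMap A _ a) = algebraMap A _ (D a) := by
  have h := fracDerivFun_div D a 1 one_ne_zero
  simp only [map_one, div_one, Derivation.map_one_eq_zero, map_zero, mul_zero, sub_zero,
    mul_one, one_pow] at h
  exact h

theorem derivation_ext_frac {D E : Derivation ℂ (FractionRing A) (FractionRing A)}
    (h : ∀ a : A, D (algebraMap A _ a) = E (algebraMap A _ a)) : D = E := by
  ext f
  obtain ⟨a, b, hb, rfl⟩ := IsFractionRing.div_surjective A f
  have hb := nonZeroDivisors.ne_zero hb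
  have hb' : algebraMap A (FractionRing A) b ≠ 0 := by simpa using hb
  have key : ∀ D : Derivation ℂ (FractionRing A) (FractionRing A),
      D (algebraMap A _ a) = algebraMap A _ a / algebraMap A _ b * D (algebraMap A _ b) +
        algebraMap A _ b * D (algebraMap A _ a / algebraMap A _ b) := by
    intro D
    conv_lhs => rw [← div_mul_cancel₀ (algebraMap A (FractionRing A) a) hb']
    rw [Derivation.leibniz, smul_eq_mul, smul_eq_mul]
  have h1 := key D
  have h2 := key E
  rw [h a, h b, h2] at h1
  exact (mul_left_cancel₀ hb' (add_left_cancel h1)).symm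

end FracDeriv

/-! ### The Poisson-Weyl algebra and its field of fractions -/

/-- The algebra of polynomial functions on `(ℂ²)ⁿ`; the variable `(i, 0)` is `xᵢ` and the
variable `(i, 1)` is `yᵢ`. -/
abbrev P (n : ℕ) : Type := MvPolynomial (Fin n × Fin 2) ℂ

/-- The field of fractions of the Poisson-Weyl algebra. -/
abbrev K (n : ℕ) : Type := FractionRing (P n)

/-- The coordinate functions in `K n`. -/
def coord {n : ℕ} (p : Fin n × Fin 2) : K n := algebraMap (P n) (K n) (MvPolynomial.X p)

def x {n : ℕ} (i : Fin n) : K n := coord (i, 0)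

def y {n : ℕ} (i : Fin n) : K n := coord (i, 1)

/-- The partial derivative of a rational function with respect to a coordinate. -/
def partialD {n : ℕ} (p : Fin n × Fin 2) : Derivation ℂ (K n) (K n) :=
  fracDeriv (MvPolynomial.pderiv p)

/-- `{f, g} = ∑ᵢ (∂f/∂xᵢ ∂g/∂yᵢ - ∂f/∂yᵢ ∂g/∂xᵢ)`, so that `{xᵢ, yⱼ} = δᵢⱼ`. -/
def bracket {n : ℕ} (f g : K n) : K n :=
  ∑ i : Fin n, (partialD (i, 0) f * partialD (i, 1) g - partialD (i, 1) f * partialD (i, 0) g)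

theorem partialD_coord {n : ℕ} (p q : Fin n × Fin 2) :
    partialD p (coord q) = if q = p then 1 else 0 := by
  unfold partialD coord
  rw [fracDeriv_algebraMap, MvPolynomial.pderiv_X, Pi.single_apply]
  split_ifs <;> simp_all

theorem derivation_ext {n : ℕ} {D E : Derivation ℂ (K n) (K n)}
    (h : ∀ p, D (coord p) = E (coord p)) : D = E := by
  apply derivation_ext_frac
  intro a
  have : D.compAlgebraMap (P n) = E.compAlgebraMap (P n) :=
    MvPolynomial.derivation_ext fun p => h p
  exact DFunLike.congr_fun this a

theorem partialD_comm {n : ℕ} (p q : Fin n × Fin 2) (f : K n) :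
    partialD p (partialD q f) = partialD q (partialD p f) := by
  have : ⁅partialD p, partialD q⁆ = (0 : Derivation ℂ (K n) (K n)) := by
    apply derivation_ext
    intro r
    rw [Derivation.commutator_apply, partialD_coord, partialD_coord]
    split_ifs <;> simp
  have h := DFunLike.congr_fun this f
  rw [Derivation.commutator_apply] at h
  exact sub_eq_zero.mp h

/-- The Hamiltonian derivation `{f, ·}`. -/
def ham {n : ℕ} (f : K n) : Derivation ℂ (K n) (K n) :=
  ∑ i : Fin n, (partialD (i, 0) f • partialD (i, 1) - partialD (i, 1) f • partialD (i, 0))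

theorem ham_apply {n : ℕ} (f g : K n) : ham f g = bracket f g := by
  unfold ham bracket
  rw [← Derivation.coeFnAddMonoidHom_apply, map_sum, Finset.sum_apply]
  rfl

theorem bracket_skew {n : ℕ} (f g : K n) : bracket f g = -bracket g f := by
  unfold bracket
  rw [← Finset.sum_neg_distrib]
  exact Finset.sum_congr rfl fun i _ => by ring

theorem partialD_bracket {n : ℕ} (p : Fin n × Fin 2) (f g : K n) :
    partialD p (bracket f g) = bracket (partialD p f) g + bracket f (partialD p g) := by
  unfold bracket
  rw [map_sum, ← Finset.sum_add_distrib]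
  refine Finset.sum_congr rfl fun i _ => ?_
  simp only [map_sub, Derivation.leibniz, smul_eq_mul, partialD_comm p]
  ring

theorem bracket_coord_zero {n : ℕ} (f : K n) (i : Fin n) :
    bracket f (coord (i, 0)) = -partialD (i, 1) f := by
  simp [bracket, partialD_coord, Finset.sum_ite_eq]

theorem bracket_coord_one {n : ℕ} (f : K n) (i : Fin n) :
    bracket f (coord (i, 1)) = partialD (i, 0) f := by
  simp [bracket, partialD_coord, Finset.sum_ite_eq]

theorem ham_bracket {n : ℕ} (f g : K n) : ⁅ham f, ham g⁆ = ham (bracket f g) := by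
  apply derivation_ext
  rintro ⟨i, a⟩
  rw [Derivation.commutator_apply]
  simp only [ham_apply]
  have hn : ∀ u v : K n, bracket u (-v) = -bracket u v := fun u v => by
    rw [← ham_apply, map_neg, ham_apply]
  fin_cases a
  · simp only [Fin.zero_eta, bracket_coord_zero, hn, partialD_bracket]
    rw [bracket_skew g]
    ring
  · simp only [Fin.mk_one, bracket_coord_one, partialD_bracket]
    rw [bracket_skew g]
    ring

/-- `K n` as a Poisson field. -/
instance instPoissonK (n : ℕ) : PoissonAlgebra ℂ (K n) where
  pb := bracket
  pb_add f g h := by simp only [← ham_apply, map_add]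
  pb_smul c f g := by simp only [← ham_apply, Derivation.map_smul]
  pb_self f := by
    unfold bracket
    exact Finset.sum_eq_zero fun i _ => by ring
  pb_skew := bracket_skew
  pb_mul f g h := by simp only [← ham_apply, Derivation.leibniz, smul_eq_mul]
  pb_jacobi f g h := by
    have h1 := DFunLike.congr_fun (ham_bracket f g) h
    rw [Derivation.commutator_apply] at h1
    simp only [ham_apply] at h1
    have hn : ∀ u v : K n, bracket u (-v) = -bracket u v := fun u v => by
      rw [← ham_apply, map_neg, ham_apply]
    rw [bracket_skew h f, hn, bracket_skew h (bracket f g), ← h1]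
    ring

/-! ### Invariants of groups of Poisson automorphisms -/

/-- Field automorphisms preserving the bracket. -/
def IsPoissonAut {n : ℕ} (s : K n ≃ₐ[ℂ] K n) : Prop :=
  ∀ f g, s (bracket f g) = bracket (s f) (s g)

/-- It suffices to compare brackets of coordinate functions. -/
theorem isPoissonAut_of_coord {n : ℕ} (s : K n ≃ₐ[ℂ] K n)
    (h : ∀ p q, s (bracket (coord p) (coord q)) = bracket (s (coord p)) (s (coord q))) :
    IsPoissonAut s := by
  let T : K n → Derivation ℂ (K n) (K n) := fun f =>
    Derivation.mk' (s.symm.toLinearMap ∘ₗ (ham (s f)).toLinearMap ∘ₗ s.toLinearMap) (by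
      intro a b
      change s.symm (ham (s f) (s (a * b))) =
        a • s.symm (ham (s f) (s b)) + b • s.symm (ham (s f) (s a))
      rw [map_mul, Derivation.leibniz]
      simp)
  have hT : ∀ f g, T f g = s.symm (bracket (s f) (s g)) := fun f g => by
    rw [← ham_apply]; rfl
  have step : ∀ f p, T f (coord p) = ham f (coord p) := by
    intro f p
    have e1 : T f (coord p) = -T (coord p) f := by
      rw [hT, hT, bracket_skew, map_neg]
    have e2 : T (coord p) = ham (coord p) := by
      apply derivation_ext
      intro q
      rw [hT, ← h, AlgEquiv.symm_apply_apply, ham_apply]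
    rw [e1, e2, ham_apply, ham_apply, ← bracket_skew]
  intro f g
  have e : T f = ham f := derivation_ext (step f)
  have e' := DFunLike.congr_fun e g
  rw [hT, ham_apply] at e'
  rw [← e', AlgEquiv.apply_symm_apply]

/-- The field of invariants of a group of Poisson automorphisms, with the restricted bracket. -/
@[reducible]
def invariantsPoisson {n : ℕ} (H : Subgroup (K n ≃ₐ[ℂ] K n)) (hH : ∀ s ∈ H, IsPoissonAut s) :
    PoissonAlgebra ℂ (IntermediateField.fixedField H) where
  pb f g := ⟨bracket f.1 g.1, by
    rw [IntermediateField.mem_fixedField_iff]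
    intro s hs
    rw [hH s hs, (IntermediateField.mem_fixedField_iff H _).mp f.2 s hs,
      (IntermediateField.mem_fixedField_iff H _).mp g.2 s hs]⟩
  pb_add f g h := Subtype.ext (PoissonAlgebra.pb_add (R := ℂ) f.1 g.1 h.1)
  pb_smul c f g := Subtype.ext (PoissonAlgebra.pb_smul (R := ℂ) c f.1 g.1)
  pb_self f := Subtype.ext (PoissonAlgebra.pb_self (R := ℂ) f.1)
  pb_skew f g := Subtype.ext (PoissonAlgebra.pb_skew (R := ℂ) f.1 g.1)
  pb_mul f g h := Subtype.ext (PoissonAlgebra.pb_mul (R := ℂ) f.1 g.1 h.1)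
  pb_jacobi f g h := Subtype.ext (PoissonAlgebra.pb_jacobi (R := ℂ) f.1 g.1 h.1)

/-! ### The wreath product and its action -/

abbrev SL2 : Type := Matrix.SpecialLinearGroup (Fin 2) ℂ

/-- The wreath product `Γ ≀ Sₙ = Γⁿ ⋊ Sₙ`, where `σ` maps `(γᵢ)ᵢ` to `(γ_{σ⁻¹ i})ᵢ`. -/
abbrev Wreath (Γ : Subgroup SL2) (n : ℕ) : Type :=
  (Fin n → Γ) ⋊[mulAutArrow (G := Equiv.Perm (Fin n)) (A := Fin n) (M := Γ)]
    Equiv.Perm (Fin n)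

/-- The matrix of the natural action on `(ℂ²)ⁿ`:
`(γ, σ)` sends `(pᵢ)ᵢ` to `(γᵢ p_{σ⁻¹ i})ᵢ`. -/
def wreathMat (Γ : Subgroup SL2) (n : ℕ) (g : Wreath Γ n) :
    Matrix (Fin n × Fin 2) (Fin n × Fin 2) ℂ :=
  Matrix.of fun p q =>
    if g.right⁻¹ p.1 = q.1 then ((g.left p.1 : SL2) : Matrix (Fin 2) (Fin 2) ℂ) p.2 q.2 else 0

/-- The natural representation of `Γ ≀ Sₙ` on `(ℂ²)ⁿ`. -/
def wreathMatrix (Γ : Subgroup SL2) (n : ℕ) :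
    Wreath Γ n →* Matrix (Fin n × Fin 2) (Fin n × Fin 2) ℂ where
  toFun := wreathMat Γ n
  map_one' := by
    ext ⟨i, a⟩ ⟨j, b⟩
    simp [wreathMat, Matrix.one_apply, Prod.ext_iff, ite_and]
  map_mul' g h := by
    ext ⟨i, a⟩ ⟨j, b⟩
    have hl : (g * h).left i = g.left i * h.left (g.right⁻¹ i) := rfl
    have hr : (g * h).right⁻¹ i = h.right⁻¹ (g.right⁻¹ i) := by
      rw [SemidirectProduct.mul_right, mul_inv_rev, Equiv.Perm.mul_apply]
    rw [Matrix.mul_apply, Fintype.sum_prod_type, Finset.sum_eq_single (g.right⁻¹ i)]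
    · simp only [wreathMat, Matrix.of_apply, hl, hr, if_true, Subgroup.coe_mul,
        Matrix.SpecialLinearGroup.coe_mul, Matrix.mul_apply]
      split_ifs <;> simp
    · intro k _ hk
      refine Finset.sum_eq_zero fun c _ => ?_
      rw [wreathMat, Matrix.of_apply, if_neg hk.symm, zero_mul]
    · simp

/-- The substitution of linear forms `z_p ↦ ∑_q A p q z_q`, i.e. `f ↦ f ∘ A`. -/
def linSubst {n : ℕ} (A : Matrix (Fin n × Fin 2) (Fin n × Fin 2) ℂ) : P n →ₐ[ℂ] P n :=
  MvPolynomial.aeval fun p => ∑ q, MvPolynomial.C (A p q) * MvPolynomial.X q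

/-- The action of `Γ ≀ Sₙ` on polynomial functions, `(g f)(p) = f (g⁻¹ p)`. -/
def wreathActP (Γ : Subgroup SL2) (n : ℕ) : Wreath Γ n →* (P n →ₐ[ℂ] P n) where
  toFun g := linSubst (wreathMatrix Γ n g⁻¹)
  map_one' := by
    apply MvPolynomial.algHom_ext
    intro p
    simp [linSubst, Matrix.one_apply]
  map_mul' g h := by
    apply MvPolynomial.algHom_ext
    intro p
    simp only [linSubst, mul_inv_rev, map_mul, MvPolynomial.aeval_X, AlgHom.mul_apply,
      Matrix.mul_apply, map_sum, MvPolynomial.algHom_C, MvPolynomial.algebraMap_eq,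
      Finset.sum_mul, Finset.mul_sum]
    rw [Finset.sum_comm]
    exact Finset.sum_congr rfl fun i _ => Finset.sum_congr rfl fun j _ => by ring

/-- The induced action of `Γ ≀ Sₙ` on `K n` by field automorphisms. -/
def wreathAut (Γ : Subgroup SL2) (n : ℕ) : Wreath Γ n →* (K n ≃ₐ[ℂ] K n) :=
  (IsFractionRing.fieldEquivOfAlgEquivHom (A := ℂ) (B := P n) ℂ (K n)).comp
    ((AlgEquiv.algHomUnitsEquiv ℂ (P n)).toMonoidHom.comp (wreathActP Γ n).toHomUnits)

theorem wreathAut_coord (Γ : Subgroup SL2) (n : ℕ) (g : Wreath Γ n) (p : Fin n × Fin 2) :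
    wreathAut Γ n g (coord p) = ∑ q, wreathMatrix Γ n g⁻¹ p q • coord q := by
  have h : wreathAut Γ n g (coord p) =
      algebraMap (P n) (K n) (linSubst (wreathMatrix Γ n g⁻¹) (MvPolynomial.X p)) :=
    IsFractionRing.fieldEquivOfAlgEquiv_algebraMap _ _ _ _ _
  rw [h, linSubst, MvPolynomial.aeval_X, map_sum]
  refine Finset.sum_congr rfl fun q _ => ?_
  rw [map_mul, Algebra.smul_def, ← MvPolynomial.algebraMap_eq,
    ← IsScalarTower.algebraMap_apply]
  rfl

theorem wreathAut_isPoissonAut (Γ : Subgroup SL2) (n : ℕ) (g : Wreath Γ n) :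
    IsPoissonAut (wreathAut Γ n g) := by
  have hc : ∀ i a, wreathAut Γ n g (coord (i, a)) =
      ∑ c, ((g⁻¹.left i : SL2) : Matrix (Fin 2) (Fin 2) ℂ) a c • coord (g⁻¹.right⁻¹ i, c) := by
    intro i a
    rw [wreathAut_coord, Fintype.sum_prod_type, Finset.sum_eq_single (g⁻¹.right⁻¹ i)]
    · simp [wreathMatrix, wreathMat]
    · intro k _ hk
      refine Finset.sum_eq_zero fun c _ => ?_
      have : g.right i ≠ k := by simpa using hk.symm
      simp [wreathMatrix, wreathMat, this]
    · simp
  apply isPoissonAut_of_coord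
  rintro ⟨i, a⟩ ⟨j, b⟩
  rw [hc, hc]
  generalize g⁻¹.right⁻¹ = τ
  simp only [Fin.sum_univ_two, ← ham_apply, map_add, Derivation.map_smul]
  simp only [ham_apply, bracket_coord_zero, bracket_coord_one, map_add, Derivation.map_smul,
    partialD_coord]
  by_cases hij : i = j
  · subst hij
    generalize (g⁻¹.left i : SL2) = A
    have hdet := Matrix.det_fin_two (A : Matrix (Fin 2) (Fin 2) ℂ)
    rw [Matrix.SpecialLinearGroup.det_coe] at hdet
    have hdet' := congrArg (algebraMap ℂ (K n)) hdet
    simp only [map_one, map_sub, map_mul] at hdet'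
    fin_cases a <;> fin_cases b <;>
      simp [bracket_coord_zero, bracket_coord_one, partialD_coord, Algebra.smul_def]
    · ring
    · linear_combination hdet'
    · linear_combination -hdet'
    · ring
  · have h1 : ¬ τ i = τ j := fun h => hij (τ.injective h)
    fin_cases b <;>
      simp [bracket_coord_zero, bracket_coord_one, partialD_coord, hij, h1]

/-- The action of `Γ` on `K 1`, `(γ f)(p) = f (γ⁻¹ p)`. -/
def gammaAut (Γ : Subgroup SL2) : Γ →* (K 1 ≃ₐ[ℂ] K 1) :=
  (wreathAut Γ 1).comp (SemidirectProduct.inl.comp (Pi.constMonoidHom (Fin 1) Γ))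

/-- `(K n) ^ (Γ ≀ Sₙ)`. -/
abbrev KWreath (Γ : Subgroup SL2) (n : ℕ) : IntermediateField ℂ (K n) :=
  IntermediateField.fixedField (wreathAut Γ n).range

/-- `(K 1) ^ Γ`. -/
abbrev KGamma (Γ : Subgroup SL2) : IntermediateField ℂ (K 1) :=
  IntermediateField.fixedField (gammaAut Γ).range

instance instPoissonKWreath (Γ : Subgroup SL2) (n : ℕ) : PoissonAlgebra ℂ (KWreath Γ n) :=
  invariantsPoisson _ (by rintro _ ⟨g, rfl⟩; exact wreathAut_isPoissonAut Γ n g)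

instance instPoissonKGamma (Γ : Subgroup SL2) : PoissonAlgebra ℂ (KGamma Γ) :=
  invariantsPoisson _ (by rintro _ ⟨g, rfl⟩; exact wreathAut_isPoissonAut Γ 1 _)

/-! ### The generators -/

/-- `(u, v)` is a pair of canonical generators of `(K 1) ^ Γ`: `u ↦ x`, `v ↦ y` defines an
isomorphism of Poisson fields from `(K 1) ^ Γ` to `K 1`. -/
def IsCanonicalPair (Γ : Subgroup SL2) (u v : K 1) : Prop :=
  ∃ e : PoissonEquiv ℂ (KGamma Γ) (K 1),
    ((e.toAlgEquiv.symm (x 0) : KGamma Γ) : K 1) = u ∧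
    ((e.toAlgEquiv.symm (y 0) : KGamma Γ) : K 1) = v

/-- `t = y / x`. -/
def ratio : K 1 := y 0 / x 0

/-- `ℂ(t) ^ Γ`, the invariant rational functions of `t = y / x`. -/
def ratioInvariants (Γ : Subgroup SL2) : IntermediateField ℂ (K 1) :=
  IntermediateField.adjoin ℂ {ratio} ⊓ KGamma Γ

/-- `∏ (s - a)` over the `Γ`-orbit of `t = y / x`. -/
def orbitProduct (Γ : Subgroup SL2) (a : ℂ) : K 1 :=
  ∏ᶠ s ∈ Set.range fun g : Γ => gammaAut Γ g ratio, (s - algebraMap ℂ (K 1) a)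

/-- A linear form in `x, y` that spans a `Γ`-stable line. -/
def IsEigenform (Γ : Subgroup SL2) (l : K 1) : Prop :=
  (∃ α β : ℂ, l = α • x 0 + β • y 0) ∧ ∀ g : Γ, ∃ c : ℂ, gammaAut Γ g l = c • l

/-- The explicit generators of `(K 1) ^ Γ`. In the second case `v` is a function of `t = y / x`,
and `x * ∂v/∂y` is its derivative `dv/dt`. -/
inductive ExplicitPair (Γ : Subgroup SL2) : K 1 → K 1 → Prop
  | cyclic (l₁ l₂ : K 1) (h₁ : IsEigenform Γ l₁) (h₂ : IsEigenform Γ l₂)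
      (h : bracket l₁ l₂ = 1) :
      ExplicitPair Γ (l₁ / ((Nat.card Γ : K 1) * l₂ ^ (Nat.card Γ - 1))) (l₂ ^ Nat.card Γ)
  | even (v : K 1) (hΓ : (-1 : SL2) ∈ Γ)
      (hv : IntermediateField.adjoin ℂ {v} = ratioInvariants Γ) :
      ExplicitPair Γ (x 0 ^ 2 / (2 * (x 0 * partialD (0, 1) v))) v

/-- The embedding `P 1 → K n` as functions of the `i`-th factor: `x ↦ xᵢ`, `y ↦ yᵢ`. -/
def factorP {n : ℕ} (i : Fin n) : P 1 →ₐ[ℂ] K n :=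
  (Algebra.algHom ℂ (P n) (K n)).comp (MvPolynomial.rename fun p : Fin 1 × Fin 2 => (i, p.2))

theorem factorP_injective {n : ℕ} (i : Fin n) : Function.Injective (factorP i) := by
  have h : Function.Injective (MvPolynomial.rename (R := ℂ)
      fun p : Fin 1 × Fin 2 => (i, p.2)) := by
    refine MvPolynomial.rename_injective _ ?_
    rintro ⟨a, b⟩ ⟨c, d⟩ h
    exact Prod.ext (Subsingleton.elim _ _) (Prod.ext_iff.mp h).2
  intro f g hfg
  exact h (IsFractionRing.injective (P n) (K n) hfg)

/-- The embedding `K 1 → K n` as functions of the `i`-th factor: `x ↦ xᵢ`, `y ↦ yᵢ`. -/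
def factor {n : ℕ} (i : Fin n) : K 1 →ₐ[ℂ] K n :=
  IsFractionRing.liftAlgHom (factorP_injective i)

/-- The elementary symmetric polynomial `e_{j+1}` in `n` variables, `j = 0, …, n - 1`. -/
def elem (n : ℕ) (j : Fin n) : MvPolynomial (Fin n) ℂ :=
  MvPolynomial.esymm (Fin n) ℂ (j + 1)

/-- The Jacobian matrix `(∂e_j / ∂z_i)_{i j}` of the elementary symmetric polynomials, evaluated
at `z_i = v_i`, where `v_i` is the copy of `v` in the `i`-th factor. -/
def jacobian (n : ℕ) (v : K 1) : Matrix (Fin n) (Fin n) (K n) :=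
  Matrix.of fun i j => MvPolynomial.aeval (fun k => factor k v) (MvPolynomial.pderiv i (elem n j))

/-- `V_j = e_j (v_1, …, v_n)`. -/
def bigV (n : ℕ) (v : K 1) (j : Fin n) : K n :=
  MvPolynomial.aeval (fun k => factor k v) (elem n j)

/-- `U_i = ∑_j (M⁻¹)_{ij} u_j` for the Jacobian matrix `M`. -/
def bigU (n : ℕ) (u v : K 1) (i : Fin n) : K n :=
  ∑ j, (jacobian n v)⁻¹ i j * factor j u

end PoissonNoether

end

noncomputable section

namespace PoissonNoether

/-! Suppose 2n elements `a p` of `K n` have the same mutual brackets as the coordinates. Bracketing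
a polynomial relation between them with each `a p` shows that its partial derivatives are relations
too, of lower degree; so they are algebraically independent (`IsCanonical.algebraicIndependent`).
Hence `K n` is algebraic over ℂ(a), and sending coordinates to the `a p` is a Poisson isomorphism of
`K n` onto ℂ(a). If the `a p` are invariant under H, it remains to see that ℂ(a) is the whole fixed
field. By `IsCanonical.adjoin_eq_fixedField` it suffices that every embedding of `K n` in its
algebraic closure that fixes the `a p` is given by an element of H. No degree of `K n` over ℂ(a) is
ever computed.

For n = 1 this criterion is checked by hand. In (E1) an embedding fixing v multiplies l₂ by an m-th
root of unity, and Γ realises all of these. In (E2) it sends t to a conjugate of t and then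
determines x up to a sign, which -1 ∈ Γ absorbs. If -1 ∉ Γ, then Γ has odd order, and a character
sum shows that its natural representation is reducible; this gives the two eigenforms. If -1 ∈ Γ, a
generator v comes from part (1), where `adjoin_orbitProduct` compares the degrees of t over ℂ(v) and
over ℂ(t)^Γ.

For general n, M is the matrix of brackets {u_i, V_j}. A derivation killing all V_j kills the v_i,
which are roots of a polynomial with coefficients in ℂ(V). This makes M invertible, and with the
Jacobi identity it gives {U_i, U_j} = 0. An embedding fixing all U_i and V_i permutes the v_i, hence
permutes the u_i in the same way because u = M U, and on each factor it is then given by an element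
of Γ. These data form an element of the wreath product. -/

/-! ### Embeddings of algebraic extensions and constants of derivations -/

open Polynomial in
/-- Two ring homomorphisms into a domain that agree on the coefficients of `∏ (X - s i)` send
each `s i` to the same set. -/
theorem exists_map_eq_of_prod_map_eq {A B ι : Type*} [CommRing A] [CommRing B] [IsDomain B]
    [Fintype ι] (τ j : A →+* B) (s : ι → A)
    (h : (∏ i, (X - C (s i))).map τ = (∏ i, (X - C (s i))).map j) (i : ι) :
    ∃ k, τ (s i) = j (s k) := by
  have h1 : ((∏ i, (X - C (s i))).map τ).eval (τ (s i)) = 0 := by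
    rw [eval_map_apply, eval_prod, Finset.prod_eq_zero (Finset.mem_univ i) (by simp), map_zero]
  rw [h, Polynomial.map_prod, eval_prod, Finset.prod_eq_zero_iff] at h1
  obtain ⟨k, -, hk⟩ := h1
  exact ⟨k, by simpa [sub_eq_zero] using hk⟩

/-- An element of an algebraic extension in characteristic zero that is fixed by all embeddings
into an algebraically closed field lies in the base field. -/
theorem mem_range_of_forall_algHom {F E Ω : Type*} [Field F] [CharZero F] [Field E] [Field Ω]
    [IsAlgClosed Ω] [Algebra F E] [Algebra F Ω] [Algebra.IsAlgebraic F E] (z : E) (w : Ω)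
    (h : ∀ τ : E →ₐ[F] Ω, τ z = w) : z ∈ (algebraMap F E).range := by
  have hz : IsIntegral F z := Algebra.IsIntegral.isIntegral z
  have hr := Algebra.IsAlgebraic.range_eval_eq_rootSet_minpoly (F := F) Ω z
  have hs : (minpoly F z).rootSet Ω ⊆ {w} := by
    rw [← hr]
    rintro _ ⟨τ, rfl⟩
    exact h τ
  have hc := Polynomial.card_rootSet_eq_natDegree (K := Ω) (minpoly.irreducible hz).separable
    (IsAlgClosed.splits _)
  -- The minimal polynomial is separable, so its degree is the number of its roots, and `w` is the
  -- only one.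
  have hle : (minpoly F z).natDegree ≤ 1 := by
    rw [← hc, ← Nat.card_eq_fintype_card]
    exact (Nat.card_mono (Set.finite_singleton w) hs).trans (by simp)
  have := minpoly.natDegree_pos hz
  apply minpoly.mem_range_of_degree_eq_one
  rw [Polynomial.degree_eq_natDegree (minpoly.ne_zero hz)]
  norm_cast
  omega

/-- Comparison of two subfields of `k(t)` by the degree of `t`. -/
theorem eq_of_natDegree_minpoly_le {k E : Type*} [Field k] [Field E] [Algebra k E] {t : E}
    {L F : IntermediateField k E} (hLF : L ≤ F) (hF : F ≤ IntermediateField.adjoin k {t})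
    (ht : IsIntegral L t) (h : (minpoly L t).natDegree ≤ (minpoly F t).natDegree) : L = F := by
  have key : ∀ M : IntermediateField k E, M ≤ IntermediateField.adjoin k {t} → IsIntegral M t →
      IntermediateField.relfinrank M (IntermediateField.adjoin k {t}) =
        (minpoly M t).natDegree := by
    intro M hM hi
    rw [IntermediateField.relfinrank_eq_finrank_of_le hM, IntermediateField.extendScalars_adjoin,
      IntermediateField.adjoin.finrank hi]
  have ht' : IsIntegral F t := by
    obtain ⟨p, hp, hpt⟩ := ht
    refine ⟨p.map (IntermediateField.inclusion hLF).toRingHom, hp.map _, ?_⟩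
    rw [Polynomial.eval₂_map]
    exact hpt
  -- Tower law for L ≤ F ≤ k(t), in which the degrees of k(t) over L and F are those of the minimal
  -- polynomials of t.
  have h1 := IntermediateField.relfinrank_mul_relfinrank hLF hF
  rw [key L (hLF.trans hF) ht, key F hF ht'] at h1
  have h2 := minpoly.natDegree_pos ht'
  refine le_antisymm hLF (IntermediateField.relfinrank_eq_one_iff.mp ?_)
  have h3 := minpoly.natDegree_pos ht
  rcases Nat.lt_or_ge 1 (L.relfinrank F) with h4 | h4
  · nlinarith
  · rcases Nat.eq_zero_or_pos (L.relfinrank F) with h5 | h5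
    · rw [h5] at h1; omega
    · omega

/-- The constants of a derivation of a field. -/
def derivKer {k E : Type*} [Field k] [Field E] [Algebra k E] (D : Derivation k E E) :
    IntermediateField k E where
  carrier := {f | D f = 0}
  mul_mem' {f g} hf hg := by
    change D (f * g) = 0
    rw [Derivation.leibniz, hf, hg, smul_zero, smul_zero, add_zero]
  add_mem' {f g} hf hg := by
    change D (f + g) = 0
    rw [map_add, hf, hg, add_zero]
  algebraMap_mem' c := D.map_algebraMap c
  inv_mem' f hf := by
    change D f⁻¹ = 0
    rw [Derivation.leibniz_inv, hf, smul_zero]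

theorem mem_derivKer {k E : Type*} [Field k] [Field E] [Algebra k E] {D : Derivation k E E}
    {f : E} : f ∈ derivKer D ↔ D f = 0 := Iff.rfl

/-- In characteristic zero, a root of a nonzero polynomial with constant coefficients is a
constant. -/
theorem mem_derivKer_of_isAlgebraic {k E : Type*} [Field k] [Field E] [CharZero E] [Algebra k E]
    {D : Derivation k E E} {t : E} (ht : IsAlgebraic (derivKer D) t) : D t = 0 := by
  -- `D` is linear over its constants, so applying it to p(t) = 0, with p the minimal polynomial,
  -- gives p'(t) D t = 0; separability makes p'(t) nonzero.
  let D' : Derivation (derivKer D) E E := Derivation.mk'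
    { toFun := D
      map_add' := map_add D
      map_smul' := fun c f => by
        change D (c.1 * f) = c.1 * D f
        rw [Derivation.leibniz, mem_derivKer.mp c.2, smul_zero, add_zero, smul_eq_mul] }
    fun f g => D.leibniz f g
  have h := D'.map_aeval (minpoly (derivKer D) t) t
  rw [minpoly.aeval, map_zero] at h
  have hne := (minpoly.irreducible ht.isIntegral).separable.aeval_derivative_ne_zero
    (minpoly.aeval _ t)
  exact (smul_eq_zero.mp h.symm).resolve_left hne

open Polynomial in
/-- If the coefficients of `∏ (X - s i)` are constants, then so are the `s i`. -/
theorem derivation_eq_zero_of_prod {k E ι : Type*} [Field k] [Field E] [CharZero E] [Algebra k E]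
    [Fintype ι] {D : Derivation k E E} (s : ι → E)
    (h : ∀ m, D ((∏ i, (X - C (s i))).coeff m) = 0) (i : ι) : D (s i) = 0 := by
  apply mem_derivKer_of_isAlgebraic
  have hl : (∏ i, (X - C (s i))) ∈ Polynomial.lifts (algebraMap (derivKer D) E) := by
    rw [Polynomial.lifts_iff_coeff_lifts]
    exact fun m => ⟨⟨_, h m⟩, rfl⟩
  obtain ⟨q, hq⟩ := hl
  have hq : q.map (algebraMap (derivKer D) E) = ∏ i, (X - C (s i)) := hq
  refine ⟨q, ?_, ?_⟩
  · rintro rfl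
    rw [Polynomial.map_zero] at hq
    exact (monic_prod_of_monic _ _ fun i _ => monic_X_sub_C (s i)).ne_zero hq.symm
  · rw [aeval_def, ← eval_map, hq, eval_prod, Finset.prod_eq_zero (Finset.mem_univ i) (by simp)]

/-! ### Homomorphisms of the fields `K n` -/

theorem algHom_ext_coord {n : ℕ} {B : Type*} [Semiring B] [Algebra ℂ B] {f g : K n →ₐ[ℂ] B}
    (h : ∀ p, f (coord p) = g (coord p)) : f = g :=
  IsLocalization.algHom_ext (nonZeroDivisors (P n)) (MvPolynomial.algHom_ext fun p => h p)

/-- A derivation along a homomorphism that vanishes on coordinate functions is zero. -/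
theorem twisted_derivation_eq_zero {m n : ℕ} (φ : K m →ₐ[ℂ] K n) (D : K m →ₗ[ℂ] K n)
    (hD : ∀ f g, D (f * g) = φ f * D g + φ g * D f) (h : ∀ p, D (coord p) = 0) (f : K m) :
    D f = 0 := by
  have h1 : D 1 = 0 := by
    have := hD 1 1
    simpa using this
  have hP : ∀ a : P m, D (algebraMap _ _ a) = 0 := by
    intro a
    induction a using MvPolynomial.induction_on with
    | C c =>
      have : algebraMap (P m) (K m) (MvPolynomial.C c) = c • 1 := by
        rw [Algebra.smul_def, mul_one, ← MvPolynomial.algebraMap_eq,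
          ← IsScalarTower.algebraMap_apply]
      rw [this, map_smul, h1, smul_zero]
    | add p q hp hq => rw [map_add, map_add, hp, hq, add_zero]
    | mul_X p i hp =>
      have := h i
      unfold coord at this
      rw [map_mul, hD, hp, this, mul_zero, mul_zero, add_zero]
  obtain ⟨a, b, hb, rfl⟩ := IsFractionRing.div_surjective (A := P m) f
  have hb := nonZeroDivisors.ne_zero hb
  have hb' : algebraMap (P m) (K m) b ≠ 0 := by simpa using hb
  have h2 := hD (algebraMap _ _ a / algebraMap _ _ b) (algebraMap _ _ b)
  rw [div_mul_cancel₀ _ hb', hP, hP, mul_zero, zero_add] at h2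
  exact (mul_eq_zero.mp h2.symm).resolve_left (by simpa using hb)

theorem bracket_coord_coord {n : ℕ} (p q : Fin n × Fin 2) : ∃ c : ℂ,
    bracket (coord p) (coord q) = algebraMap ℂ (K n) c := by
  obtain ⟨i, b⟩ := q
  fin_cases b
  · refine ⟨if p = (i, 1) then -1 else 0, ?_⟩
    simp only [Fin.zero_eta, bracket_coord_zero, partialD_coord]
    split_ifs <;> simp
  · refine ⟨if p = (i, 0) then 1 else 0, ?_⟩
    simp only [Fin.mk_one, bracket_coord_one, partialD_coord]
    split_ifs <;> simp

/-- A homomorphism preserving the brackets of coordinate functions preserves all brackets. -/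
theorem map_bracket_of_coord {m n : ℕ} (φ : K m →ₐ[ℂ] K n)
    (h : ∀ p q, bracket (φ (coord p)) (φ (coord q)) = φ (bracket (coord p) (coord q)))
    (f g : K m) : φ (bracket f g) = bracket (φ f) (φ g) := by
  -- For fixed `f` the failure to preserve the bracket is a derivation along `φ` in the second
  -- argument, so coordinates suffice there. Skew symmetry then allows the same reduction in the
  -- first argument.
  have key : ∀ f : K m, (∀ p, bracket (φ f) (φ (coord p)) = φ (bracket f (coord p))) →
      ∀ g, bracket (φ f) (φ g) = φ (bracket f g) := by
    intro f hf g
    have := twisted_derivation_eq_zero φ ((ham (φ f)).toLinearMap ∘ₗ φ.toLinearMap -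
      φ.toLinearMap ∘ₗ (ham f).toLinearMap) (fun a b => by
        change ham (φ f) (φ (a * b)) - φ (ham f (a * b)) =
          φ a * (ham (φ f) (φ b) - φ (ham f b)) + φ b * (ham (φ f) (φ a) - φ (ham f a))
        simp only [map_mul, Derivation.leibniz, smul_eq_mul, map_add]
        ring) (fun p => by
        change ham (φ f) (φ (coord p)) - φ (ham f (coord p)) = 0
        rw [ham_apply, ham_apply, hf, sub_self]) g
    change ham (φ f) (φ g) - φ (ham f g) = 0 at this
    rwa [ham_apply, ham_apply, sub_eq_zero] at this
  refine (key f (fun p => ?_) g).symm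
  rw [bracket_skew, key _ (h p) f, ← map_neg, ← bracket_skew]

/-! ### Canonical coordinates on fields of invariants -/

/-- Families with the brackets of the coordinate functions. -/
def IsCanonical {n : ℕ} (a : Fin n × Fin 2 → K n) : Prop :=
  ∀ p q, bracket (a p) (a q) = bracket (coord p) (coord q)

/-- The chain rule for the derivation {f, ·}. -/
theorem ham_aeval {n : ℕ} {σ : Type*} [Fintype σ] (f : K n) (a : σ → K n)
    (q : MvPolynomial σ ℂ) :
    bracket f (MvPolynomial.aeval a q) =
      ∑ i, MvPolynomial.aeval a (MvPolynomial.pderiv i q) * bracket f (a i) := by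
  classical
  induction q using MvPolynomial.induction_on with
  | C c =>
    rw [← ham_apply, MvPolynomial.algHom_C, Derivation.map_algebraMap]
    simp
  | add p q hp hq =>
    rw [map_add, ← ham_apply, map_add, ham_apply, ham_apply, hp, hq, ← Finset.sum_add_distrib]
    exact Finset.sum_congr rfl fun i _ => by rw [map_add, map_add, add_mul]
  | mul_X p j hp =>
    rw [map_mul, ← ham_apply, Derivation.leibniz, ham_apply, ham_apply, hp,
      MvPolynomial.aeval_X, smul_eq_mul, smul_eq_mul, Finset.mul_sum]
    simp only [Derivation.leibniz, map_add, smul_eq_mul, map_mul, MvPolynomial.aeval_X, add_mul,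
      MvPolynomial.pderiv_X, Finset.sum_add_distrib]
    congr 1
    · rw [Finset.sum_eq_single j]
      · simp
      · intro i _ hi
        rw [Pi.single_eq_of_ne hi.symm]
        simp
      · simp
    · exact Finset.sum_congr rfl fun i _ => by ring

/-- Bracketing the relation with `a r` gives a linear relation between the values of the partial
derivatives. Its coefficients are the brackets of coordinates, so taking for `r` the conjugate of
`p` isolates the derivative at `p`. -/
theorem IsCanonical.aeval_pderiv {n : ℕ} {a : Fin n × Fin 2 → K n} (ha : IsCanonical a)
    {q : P n} (hq : MvPolynomial.aeval a q = 0) (p : Fin n × Fin 2) :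
    MvPolynomial.aeval a (MvPolynomial.pderiv p q) = 0 := by
  have h : ∀ r, ∑ i, MvPolynomial.aeval a (MvPolynomial.pderiv i q) *
      bracket (coord r) (coord i) = 0 := by
    intro r
    have := ham_aeval (a r) a q
    rw [hq, ← ham_apply, map_zero] at this
    rw [this]
    exact Finset.sum_congr rfl fun i _ => by rw [ha]
  obtain ⟨i, b⟩ := p
  fin_cases b
  · have := h (i, 1)
    rw [Finset.sum_eq_single (i, 0)] at this
    · rw [bracket_skew, bracket_coord_one, partialD_coord, if_pos rfl, mul_neg, mul_one,
        neg_eq_zero] at this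
      exact this
    · intro q _ hq
      rw [bracket_skew, bracket_coord_one, partialD_coord, if_neg hq, neg_zero, mul_zero]
    · simp
  · have := h (i, 0)
    rw [Finset.sum_eq_single (i, 1)] at this
    · rw [bracket_skew, bracket_coord_zero, partialD_coord, if_pos rfl, neg_neg, mul_one] at this
      exact this
    · intro q _ hq
      rw [bracket_skew, bracket_coord_zero, partialD_coord, if_neg hq, neg_zero, neg_zero,
        mul_zero]
    · simp

theorem eq_C_of_pderiv_eq_zero {σ : Type*} (q : MvPolynomial σ ℂ)
    (h : ∀ i, MvPolynomial.pderiv i q = 0) : q = MvPolynomial.C (MvPolynomial.coeff 0 q) := by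
  classical
  ext m
  rw [MvPolynomial.coeff_C]
  split_ifs with hm
  · rw [hm]
  · obtain ⟨i, hi⟩ : ∃ i, m i ≠ 0 := by
      by_contra! hc
      exact hm (Finsupp.ext fun i => (hc i).symm)
    have h1 := congrArg (MvPolynomial.coeff (m - Finsupp.single i 1)) (h i)
    rw [MvPolynomial.coeff_pderiv, MvPolynomial.coeff_zero] at h1
    have h2 : m - Finsupp.single i 1 + Finsupp.single i 1 = m := by
      apply tsub_add_cancel_of_le
      rw [Finsupp.single_le_iff]
      omega
    rw [h2] at h1
    exact (mul_eq_zero.mp h1).resolve_right (Nat.cast_add_one_ne_zero _)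

theorem totalDegree_pderiv_lt {σ : Type*} (q : MvPolynomial σ ℂ) (i : σ)
    (h : MvPolynomial.pderiv i q ≠ 0) :
    (MvPolynomial.pderiv i q).totalDegree < q.totalDegree := by
  classical
  have hm : ∀ m ∈ (MvPolynomial.pderiv i q).support, m.sum (fun _ e => e) + 1 ≤ q.totalDegree := by
    intro m hm
    rw [MvPolynomial.mem_support_iff, MvPolynomial.coeff_pderiv] at hm
    have := MvPolynomial.le_totalDegree (MvPolynomial.mem_support_iff.mpr (left_ne_zero_of_mul hm))
    rwa [Finsupp.sum_add_index' (by simp) (by simp), Finsupp.sum_single_index rfl] at this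
  obtain ⟨m, hm0⟩ := MvPolynomial.support_nonempty.mpr h
  have h0 := hm m hm0
  refine lt_of_le_of_lt (b := q.totalDegree - 1) ?_ (by omega)
  exact Finset.sup_le fun m hm' => by have := hm m hm'; omega

/-- Induction on the degree: the partial derivatives of a relation are relations of smaller degree,
hence zero, so the relation is a constant, and that constant is zero. -/
theorem IsCanonical.algebraicIndependent {n : ℕ} {a : Fin n × Fin 2 → K n}
    (ha : IsCanonical a) : AlgebraicIndependent ℂ a := by
  rw [algebraicIndependent_iff]
  intro q
  induction hd : q.totalDegree using Nat.strong_induction_on generalizing q with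
  | _ d ih =>
    intro hq
    have h : ∀ i, MvPolynomial.pderiv i q = 0 := by
      intro i
      by_contra hne
      exact hne (ih _ (hd ▸ totalDegree_pderiv_lt q i hne) _ rfl (ha.aeval_pderiv hq i))
    rw [eq_C_of_pderiv_eq_zero q h] at hq ⊢
    rw [MvPolynomial.algHom_C, map_eq_zero] at hq
    rw [hq, map_zero]

theorem trdeg_K (n : ℕ) : Algebra.trdeg ℂ (K n) = Cardinal.mk (Fin n × Fin 2) := by
  have h := trdeg_add_eq (R := ℂ) (S := P n) (A := K n)
  have : Algebra.IsAlgebraic (P n) (K n) := IsLocalization.isAlgebraic (K n) (nonZeroDivisors (P n))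
  rw [trdeg_eq_zero (R := P n), add_zero, MvPolynomial.trdeg_of_isDomain,
    Cardinal.lift_id] at h
  exact h.symm

/-- As many independent elements as the transcendence degree form a transcendence basis. -/
theorem IsCanonical.isAlgebraic {n : ℕ} {a : Fin n × Fin 2 → K n} (ha : IsCanonical a) :
    Algebra.IsAlgebraic (IntermediateField.adjoin ℂ (Set.range a)) (K n) :=
  (ha.algebraicIndependent.isTranscendenceBasis_of_trdeg_le_of_finite
    (trdeg_K n).le).isAlgebraic_field

/-- The substitution `coord p ↦ a p`. -/
def IsCanonical.subst {n : ℕ} {a : Fin n × Fin 2 → K n} (ha : IsCanonical a) :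
    K n →ₐ[ℂ] K n :=
  IsFractionRing.liftAlgHom (g := MvPolynomial.aeval a)
    (algebraicIndependent_iff_injective_aeval.mp ha.algebraicIndependent)

theorem IsCanonical.subst_coord {n : ℕ} {a : Fin n × Fin 2 → K n} (ha : IsCanonical a)
    (p : Fin n × Fin 2) : ha.subst (coord p) = a p := by
  unfold subst coord
  rw [IsFractionRing.liftAlgHom_apply, IsFractionRing.lift_algebraMap]
  exact MvPolynomial.aeval_X a p

theorem IsCanonical.subst_bracket {n : ℕ} {a : Fin n × Fin 2 → K n} (ha : IsCanonical a)
    (f g : K n) : ha.subst (bracket f g) = bracket (ha.subst f) (ha.subst g) := by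
  apply map_bracket_of_coord
  intro p q
  obtain ⟨c, hc⟩ := bracket_coord_coord p q
  rw [ha.subst_coord, ha.subst_coord, ha, hc, AlgHom.commutes]

/-- The inclusion of `K n` in its algebraic closure. -/
def incl (n : ℕ) : K n →ₐ[ℂ] AlgebraicClosure (K n) := Algebra.algHom ℂ (K n) _

/-- Invariant canonical coordinates generate the field of invariants as soon as every embedding
fixing them comes from the group. -/
theorem IsCanonical.adjoin_eq_fixedField {n : ℕ} {a : Fin n × Fin 2 → K n} (ha : IsCanonical a)
    (H : Subgroup (K n ≃ₐ[ℂ] K n)) (hH : ∀ p, a p ∈ IntermediateField.fixedField H)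
    (hτ : ∀ τ : K n →ₐ[ℂ] AlgebraicClosure (K n), (∀ p, τ (a p) = incl n (a p)) →
      ∃ h ∈ H, ∀ p, τ (coord p) = incl n (h (coord p))) :
    IntermediateField.adjoin ℂ (Set.range a) = IntermediateField.fixedField H := by
  apply le_antisymm
  · rw [IntermediateField.adjoin_le_iff]
    rintro _ ⟨p, rfl⟩
    exact hH p
  · intro f hf
    have := ha.isAlgebraic
    -- Every embedding over ℂ(a) is the inclusion composed with some h ∈ H, so it sends the
    -- invariant `f` to `incl n f`.
    obtain ⟨c, hc⟩ := mem_range_of_forall_algHom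
      (F := IntermediateField.adjoin ℂ (Set.range a)) (Ω := AlgebraicClosure (K n)) f (incl n f)
      (by
        intro τ
        obtain ⟨h, hh, heq⟩ := hτ (τ.restrictScalars ℂ) (fun p => τ.commutes
          ⟨a p, IntermediateField.subset_adjoin ℂ _ ⟨p, rfl⟩⟩)
        have he : τ.restrictScalars ℂ = (incl n).comp h.toAlgHom := algHom_ext_coord heq
        have he := DFunLike.congr_fun he f
        have hf := (IntermediateField.mem_fixedField_iff H f).mp hf h hh
        change τ f = incl n (h f) at he
        rw [he, hf])
    rw [← hc]
    exact c.2

/-- The substitution is a Poisson embedding with image ℂ(a), the fixed field; the isomorphism wanted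
is its inverse. -/
theorem IsCanonical.exists_equiv {n : ℕ} {a : Fin n × Fin 2 → K n} (ha : IsCanonical a)
    (H : Subgroup (K n ≃ₐ[ℂ] K n)) (hP : ∀ s ∈ H, IsPoissonAut s)
    (h : IntermediateField.adjoin ℂ (Set.range a) = IntermediateField.fixedField H) :
    letI := invariantsPoisson H hP
    ∃ e : PoissonEquiv ℂ (IntermediateField.fixedField H) (K n),
      ∀ p, ((e.toAlgEquiv.symm (coord p) : IntermediateField.fixedField H) : K n) = a p := by
  let _ := invariantsPoisson H hP
  have hmem : ∀ f, ha.subst f ∈ IntermediateField.fixedField H := by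
    intro f
    rw [IntermediateField.mem_fixedField_iff]
    intro s hs
    have : s.toAlgHom.comp ha.subst = ha.subst := algHom_ext_coord fun p => by
      have hp : a p ∈ IntermediateField.fixedField H :=
        h ▸ IntermediateField.subset_adjoin ℂ _ ⟨p, rfl⟩
      change s (ha.subst (coord p)) = _
      rw [ha.subst_coord]
      exact (IntermediateField.mem_fixedField_iff H _).mp hp s hs
    exact DFunLike.congr_fun this f
  let φ : K n →ₐ[ℂ] IntermediateField.fixedField H :=
    ha.subst.codRestrict (IntermediateField.fixedField H).toSubalgebra hmem
  have hsurj : Function.Surjective φ := by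
    rintro ⟨f, hf⟩
    have hle : IntermediateField.adjoin ℂ (Set.range a) ≤ ha.subst.fieldRange := by
      rw [IntermediateField.adjoin_le_iff]
      rintro _ ⟨p, rfl⟩
      exact ⟨coord p, ha.subst_coord p⟩
    obtain ⟨g, hg⟩ := hle (h ▸ hf)
    exact ⟨g, Subtype.ext hg⟩
  let e := AlgEquiv.ofBijective φ ⟨φ.toRingHom.injective, hsurj⟩
  refine ⟨⟨e.symm, ?_⟩, ?_⟩
  · intro f g
    rw [AlgEquiv.symm_apply_eq]
    apply Subtype.ext
    change bracket f.1 g.1 = ha.subst (bracket (e.symm f) (e.symm g))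
    rw [ha.subst_bracket]
    have he : ∀ f, ha.subst (e.symm f) = f.1 := fun f =>
      congrArg Subtype.val (e.apply_symm_apply f)
    rw [he, he]
  · intro p
    change ha.subst (coord p) = a p
    exact ha.subst_coord p

/-! ### Two-dimensional representations of groups of odd order -/

section OddOrder

open Matrix

section Eigenrow

variable {G : Type*} [Group G] (ρ : G →* Matrix (Fin 2) (Fin 2) ℂ)

/-- `r` is a row vector spanning a line stable under right multiplication by `ρ`. -/
def IsEigenrow (r : Fin 2 → ℂ) : Prop := ∀ g, ∃ c : ℂ, r ᵥ* ρ g = c • r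

theorem map_mul_map_inv (g : G) : ρ g * ρ g⁻¹ = 1 := by rw [← map_mul, mul_inv_cancel, map_one]

theorem map_inv_mul_map (g : G) : ρ g⁻¹ * ρ g = 1 := by rw [← map_mul, inv_mul_cancel, map_one]

/-- The sum of the conjugates of a matrix. -/
def conjSum [Fintype G] (X : Matrix (Fin 2) (Fin 2) ℂ) : Matrix (Fin 2) (Fin 2) ℂ :=
  ∑ g, ρ g * X * ρ g⁻¹

theorem conjSum_comm [Fintype G] (X : Matrix (Fin 2) (Fin 2) ℂ) (h : G) :
    ρ h * conjSum ρ X = conjSum ρ X * ρ h := by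
  have : ρ h * conjSum ρ X * ρ h⁻¹ = conjSum ρ X := by
    unfold conjSum
    rw [Finset.mul_sum, Finset.sum_mul]
    refine Fintype.sum_equiv (Equiv.mulLeft h) _ _ fun g => ?_
    simp only [Equiv.coe_mulLeft, _root_.mul_inv_rev, map_mul, Matrix.mul_assoc]
  conv_rhs => rw [← this]
  rw [Matrix.mul_assoc, Matrix.mul_assoc, map_inv_mul_map, Matrix.mul_one]

theorem trace_conjSum [Fintype G] (X : Matrix (Fin 2) (Fin 2) ℂ) :
    (conjSum ρ X).trace = Fintype.card G * X.trace := by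
  unfold conjSum
  rw [trace_sum]
  simp only [Matrix.mul_assoc]
  simp_rw [Matrix.trace_mul_comm (ρ _), Matrix.mul_assoc, map_inv_mul_map, Matrix.mul_one]
  simp

/-- A nonscalar matrix commuting with a representation yields a stable line. -/
theorem exists_isEigenrow_of_comm {A : Matrix (Fin 2) (Fin 2) ℂ} (hA : ∀ c : ℂ, A ≠ c • 1)
    (hc : ∀ g, ρ g * A = A * ρ g) : ∃ r, r ≠ 0 ∧ IsEigenrow ρ r := by
  -- `s` is a square root of the discriminant of the characteristic polynomial, so `c` is an
  -- eigenvalue of `A`, and `B` is singular but nonzero: its rows span a line.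
  obtain ⟨s, hs⟩ := IsAlgClosed.exists_pow_nat_eq (A.trace ^ 2 - 4 * A.det) (n := 2) (by norm_num)
  set c := (A.trace + s) / 2 with hcdef
  set B := A - c • 1 with hB
  have hdet : B 0 0 * B 1 1 = B 0 1 * B 1 0 := by
    rw [det_fin_two, trace_fin_two] at hs
    have e00 : B 0 0 = A 0 0 - c := by simp [hB]
    have e11 : B 1 1 = A 1 1 - c := by simp [hB]
    have e01 : B 0 1 = A 0 1 := by simp [hB]
    have e10 : B 1 0 = A 1 0 := by simp [hB]
    rw [e00, e11, e01, e10, hcdef, trace_fin_two]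
    linear_combination hs / 4
  have hB0 : B ≠ 0 := fun h => hA c (sub_eq_zero.mp h)
  obtain ⟨i, hi⟩ : ∃ i, B i ≠ 0 := by
    by_contra! h
    exact hB0 (funext h)
  have hmul : ∀ j, ∃ d : ℂ, B j = d • B i := by
    have key : ∀ j, B i 0 * B j 1 = B i 1 * B j 0 := by
      intro j
      fin_cases i <;> fin_cases j <;> simp <;> first | ring1 | linear_combination hdet |
        linear_combination -hdet
    intro j
    by_cases h0 : B i 0 = 0
    · have h1 : B i 1 ≠ 0 := fun h1 => hi (by ext k; fin_cases k <;> simp [h0, h1])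
      refine ⟨B j 1 / B i 1, ?_⟩
      have := key j
      rw [h0, zero_mul, eq_comm, mul_eq_zero] at this
      ext k
      fin_cases k
      · simp [h0, this.resolve_left h1]
      · simp [h1]
    · refine ⟨B j 0 / B i 0, ?_⟩
      ext k
      fin_cases k
      · simp [h0]
      · simp only [Fin.mk_one, Pi.smul_apply, smul_eq_mul]
        field_simp
        linear_combination key j
  -- `B` commutes with the representation, so its row space is stable.
  refine ⟨B i, hi, fun g => ?_⟩
  have hcomm : ρ g * B = B * ρ g := by
    rw [hB, Matrix.mul_sub, Matrix.sub_mul, hc, Matrix.mul_smul, Matrix.smul_mul, Matrix.mul_one,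
      Matrix.one_mul]
  have h1 : B i ᵥ* ρ g = (ρ g * B) i := by rw [hcomm]; rfl
  obtain ⟨d0, hd0⟩ := hmul 0
  obtain ⟨d1, hd1⟩ := hmul 1
  refine ⟨ρ g i 0 * d0 + ρ g i 1 * d1, ?_⟩
  rw [h1]
  ext k
  have e0 := congrFun hd0 k
  have e1 := congrFun hd1 k
  simp only [Pi.smul_apply, smul_eq_mul] at e0 e1
  simp only [Matrix.mul_apply, Fin.sum_univ_two, Pi.smul_apply, smul_eq_mul, e0, e1]
  ring

/-- A stable line has a stable complement. -/
theorem IsEigenrow.exists_complement [Finite G] {r : Fin 2 → ℂ} (hr : r ≠ 0)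
    (h : IsEigenrow ρ r) : ∃ s, IsEigenrow ρ s ∧ r 0 * s 1 - r 1 * s 0 = 1 := by
  have := Fintype.ofFinite G
  obtain ⟨w, hw⟩ : ∃ w : Fin 2 → ℂ, r 0 * w 0 + r 1 * w 1 = 1 := by
    by_cases h0 : r 0 = 0
    · have h1 : r 1 ≠ 0 := fun h1 => hr (by ext k; fin_cases k <;> simp [h0, h1])
      exact ⟨![0, (r 1)⁻¹], by simp [h1]⟩
    · exact ⟨![(r 0)⁻¹, 0], by simp [h0]⟩
  have hm : (Fintype.card G : ℂ) ≠ 0 := by exact_mod_cast Fintype.card_ne_zero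
  -- Maschke's averaging: on row vectors, `vecMulVec w r` is a projection onto the line of `r`. The
  -- sum over the group, not divided by its order, still maps into this line.
  set A := conjSum ρ (vecMulVec w r) with hA
  have hz : ∀ z : Fin 2 → ℂ, ∃ c : ℂ, z ᵥ* A = c • r := by
    intro z
    choose c hc using h
    refine ⟨∑ g, ((z ᵥ* ρ g) ⬝ᵥ w) * c g⁻¹, ?_⟩
    rw [hA, conjSum, Matrix.vecMul_sum, Finset.sum_smul]
    refine Finset.sum_congr rfl fun g _ => ?_
    rw [← Matrix.vecMul_vecMul, ← Matrix.vecMul_vecMul, Matrix.vecMul_vecMulVec,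
      Matrix.smul_vecMul, hc, smul_smul]
  -- The image of `A` lies in the line of `r`, so the factor by which `A` scales `r` is the trace of
  -- `A`.
  have hrA : r ᵥ* A = (Fintype.card G : ℂ) • r := by
    obtain ⟨c, hc⟩ := hz r
    obtain ⟨d, hd⟩ := hz ![-w 1, w 0]
    have ht := trace_conjSum ρ (vecMulVec w r)
    rw [← hA, trace_fin_two, trace_fin_two] at ht
    simp only [vecMulVec_apply] at ht
    have c0 := congrFun hc 0
    have c1 := congrFun hc 1
    have d0 := congrFun hd 0
    have d1 := congrFun hd 1
    simp only [vecMul, dotProduct, Fin.sum_univ_two, Pi.smul_apply, smul_eq_mul, cons_val_zero,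
      cons_val_one] at c0 c1 d0 d1
    have : c = Fintype.card G := by
      linear_combination ht + (Fintype.card G - c : ℂ) * hw - w 0 * c0 - w 1 * c1 + r 1 * d0 -
        r 0 * d1 + (A 0 0 + A 1 1) * hw
    rw [hc, this]
  obtain ⟨d, hd⟩ := hz ![-w 1, w 0]
  -- The vector (-w 1, w 0) has determinant 1 with `r`; subtracting a multiple of `r` preserves this
  -- and moves it into the kernel of `A`, which is stable since `A` commutes with `ρ`.
  let s : Fin 2 → ℂ := ![-w 1, w 0] - (d / Fintype.card G) • r
  have hs : s ᵥ* A = 0 := by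
    rw [Matrix.sub_vecMul, Matrix.smul_vecMul, hd, hrA, smul_smul, div_mul_cancel₀ _ hm, sub_self]
  have hrs : r 0 * s 1 - r 1 * s 0 = 1 := by
    simp only [s, Pi.sub_apply, Pi.smul_apply, smul_eq_mul, cons_val_zero, cons_val_one]
    linear_combination hw
  refine ⟨s, fun g => ?_, hrs⟩
  set q := s ᵥ* ρ g with hq
  have hqA : q ᵥ* A = 0 := by
    rw [hq, Matrix.vecMul_vecMul, conjSum_comm, ← Matrix.vecMul_vecMul, hs, Matrix.zero_vecMul]
  have hqd : q = (q 0 * s 1 - q 1 * s 0) • r + (r 0 * q 1 - r 1 * q 0) • s := by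
    ext k
    fin_cases k
    · simp only [Fin.zero_eta, Pi.add_apply, Pi.smul_apply, smul_eq_mul]
      linear_combination (-q 0) * hrs
    · simp only [Fin.mk_one, Pi.add_apply, Pi.smul_apply, smul_eq_mul]
      linear_combination (-q 1) * hrs
  rw [hqd, Matrix.add_vecMul, Matrix.smul_vecMul, Matrix.smul_vecMul, hs, hrA, smul_zero,
    add_zero, smul_smul, smul_eq_zero, or_iff_left hr, mul_eq_zero, or_iff_left hm] at hqA
  rw [hqA, zero_smul, zero_add] at hqd
  exact ⟨_, hqd⟩

theorem map_inv_eq_adjugate (hdet : ∀ g, (ρ g).det = 1) (g : G) : ρ g⁻¹ = (ρ g).adjugate := by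
  have h := (ρ g).adjugate_mul
  rw [hdet, one_smul] at h
  calc ρ g⁻¹ = (ρ g).adjugate * ρ g * ρ g⁻¹ := by rw [h, Matrix.one_mul]
    _ = _ := by rw [Matrix.mul_assoc, map_mul_map_inv, Matrix.mul_one]

/-- Representations of groups of odd order in `SL₂` have stable lines. -/
theorem exists_isEigenrow_of_odd [Finite G] (hdet : ∀ g, (ρ g).det = 1)
    (hodd : (Nat.card G).Coprime 2) : ∃ r, r ≠ 0 ∧ IsEigenrow ρ r := by
  have := Fintype.ofFinite G
  -- Either some average is not scalar and yields a stable line, or all averages are scalar; the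
  -- latter gives Schur orthogonality, used on matrix units below.
  by_cases hX : ∃ X, ∀ c : ℂ, conjSum ρ X ≠ c • 1
  · obtain ⟨X, hX⟩ := hX
    exact exists_isEigenrow_of_comm ρ hX (conjSum_comm ρ X)
  push Not at hX
  set m : ℂ := (Fintype.card G : ℂ) with hmdef
  have hm : m ≠ 0 := by simp [hmdef]
  have hR : ∀ X, conjSum ρ X = (m * X.trace / 2) • 1 := by
    intro X
    obtain ⟨c, hc⟩ := hX X
    have ht := trace_conjSum ρ X
    rw [hc, trace_smul, trace_one, smul_eq_mul, Fintype.card_fin] at ht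
    rw [hc, hmdef, ← ht]
    congr 1
    push_cast
    ring
  have hE : ∀ a b i j, ∑ g, ρ g i a * (ρ g).adjugate b j =
      ((m * (single a b (1 : ℂ)).trace / 2) • (1 : Matrix (Fin 2) (Fin 2) ℂ)) i j := by
    intro a b i j
    rw [← hR, conjSum, Matrix.sum_apply]
    refine Finset.sum_congr rfl fun g _ => ?_
    rw [map_inv_eq_adjugate ρ hdet, Matrix.mul_apply, Finset.sum_eq_single b]
    · simp
    · intro k _ hk
      rw [Matrix.mul_apply]
      simp [Ne.symm hk]
    · simp
  have h00 := hE 0 0 0 0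
  have h11 := hE 1 1 1 1
  have h01 := hE 0 1 0 1
  have h10 := hE 1 0 1 0
  simp [adjugate_fin_two] at h00 h11 h01 h10
  have htr : ∑ g, (ρ g).trace ^ 2 = m := by
    simp only [trace_fin_two]
    calc ∑ g, (ρ g 0 0 + ρ g 1 1) ^ 2 = ∑ g, (ρ g 0 0 * ρ g 1 1 + ρ g 1 1 * ρ g 0 0 +
          ρ g 0 0 * ρ g 0 0 + ρ g 1 1 * ρ g 1 1) := Finset.sum_congr rfl fun g _ => by ring
      _ = m := by
        simp only [Finset.sum_add_distrib]
        rw [h00, h11, h01, h10]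
        ring
  -- In odd order, squaring permutes the group, and tr(g²) = (tr g)² - 2 when the determinant is 1.
  -- As the squares of the traces sum to m, the traces sum to m - 2m = -m, which is not zero.
  have hsq : ∑ g, (ρ g).trace = ∑ g, ((ρ g).trace ^ 2 - 2) := by
    rw [← Equiv.sum_comp (powCoprime hodd)]
    refine Finset.sum_congr rfl fun g _ => ?_
    have hd := hdet g
    rw [det_fin_two] at hd
    simp only [powCoprime_apply, map_mul, trace_fin_two, pow_two, Matrix.mul_apply,
      Fin.sum_univ_two]
    linear_combination -2 * hd
  rw [Finset.sum_sub_distrib, htr] at hsq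
  have hS : ∑ g, ρ g ≠ 0 := by
    intro h0
    rw [← trace_sum, h0, trace_zero] at hsq
    simp only [Finset.sum_const, Finset.card_univ, nsmul_eq_mul, ← hmdef] at hsq
    apply hm
    linear_combination hsq
  -- Every row of the sum is fixed by the group, and some row is nonzero.
  obtain ⟨i, hi⟩ : ∃ i, (∑ g, ρ g) i ≠ 0 := by
    by_contra! h
    exact hS (funext h)
  refine ⟨_, hi, fun g => ⟨1, ?_⟩⟩
  have : (∑ g, ρ g) * ρ g = ∑ g, ρ g := by
    rw [Finset.sum_mul]
    exact Fintype.sum_equiv (Equiv.mulRight g) _ _ fun k => by simp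
  rw [one_smul]
  exact congrFun this i

end Eigenrow

/-- By Cauchy an even order gives an involution. In SL₂ it equals its adjugate, so it is diagonal
with equal entries ±1, and -1 is the only involution. -/
theorem coprime_two_of_neg_one_notMem (Γ : Subgroup SL2) [Finite Γ] (h : (-1 : SL2) ∉ Γ) :
    (Nat.card Γ).Coprime 2 := by
  rw [Nat.coprime_comm, Nat.Prime.coprime_iff_not_dvd Nat.prime_two]
  intro hdvd
  obtain ⟨g, hg⟩ := exists_prime_orderOf_dvd_card' 2 hdvd
  have h1 : g ^ 2 = 1 := by
    have := pow_orderOf_eq_one g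
    rwa [hg] at this
  have hne : g ≠ 1 := by
    rintro rfl
    simp at hg
  have h2 : (g : SL2) ^ 2 = 1 := by exact_mod_cast congrArg Subtype.val h1
  have h3 : ((g : SL2) : Matrix (Fin 2) (Fin 2) ℂ) = (((g : SL2)⁻¹ : SL2) : Matrix _ _ ℂ) := by
    exact congrArg Subtype.val (eq_inv_of_mul_eq_one_left (a := (g : SL2)) (b := g)
      (by rwa [← pow_two]))
  have hd := det_fin_two ((g : SL2) : Matrix (Fin 2) (Fin 2) ℂ)
  rw [Matrix.SpecialLinearGroup.det_coe] at hd
  rw [Matrix.SpecialLinearGroup.coe_inv, adjugate_fin_two] at h3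
  have e00 := congrFun (congrFun h3 0) 0
  have e01 := congrFun (congrFun h3 0) 1
  have e10 := congrFun (congrFun h3 1) 0
  simp only [of_apply, cons_val', cons_val_zero, cons_val_one, cons_val_fin_one] at e00 e01 e10
  have z01 : (g : SL2) 0 1 = 0 := by
    have : (2 : ℂ) * (g : SL2) 0 1 = 0 := by linear_combination e01
    simpa using this
  have z10 : (g : SL2) 1 0 = 0 := by
    have : (2 : ℂ) * (g : SL2) 1 0 = 0 := by linear_combination e10
    simpa using this
  have hs : ((g : SL2) 0 0 - 1) * ((g : SL2) 0 0 + 1) = 0 := by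
    linear_combination -hd + (g : SL2) 0 0 * e00 + (g : SL2) 1 0 * z01
  rcases mul_eq_zero.mp hs with h | h'
  · apply hne
    ext i j
    have := sub_eq_zero.mp h
    fin_cases i <;> fin_cases j <;> simp [z01, z10, this, ← e00]
  · apply h
    have : (g : SL2) = -1 := by
      ext i j
      have := eq_neg_of_add_eq_zero_left h'
      fin_cases i <;> fin_cases j <;> simp [z01, z10, this, ← e00]
    exact this ▸ g.2

/-- The natural representation of a subgroup of `SL₂`. -/
def natRep (Γ : Subgroup SL2) : Γ →* Matrix (Fin 2) (Fin 2) ℂ where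
  toFun g := (g : SL2)
  map_one' := rfl
  map_mul' g h := by simp

theorem exists_eigenrows (Γ : Subgroup SL2) [Finite Γ] (h : (-1 : SL2) ∉ Γ) :
    ∃ r s, IsEigenrow (natRep Γ) r ∧ IsEigenrow (natRep Γ) s ∧ r 0 * s 1 - r 1 * s 0 = 1 := by
  obtain ⟨r, hr, hr'⟩ := exists_isEigenrow_of_odd (natRep Γ)
    (fun g => Matrix.SpecialLinearGroup.det_coe (g : SL2)) (coprime_two_of_neg_one_notMem Γ h)
  obtain ⟨s, hs, hrs⟩ := hr'.exists_complement _ hr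
  exact ⟨r, s, hr', hs, hrs⟩

end OddOrder

/-! ### The action of `Γ` on `K 1` -/

theorem wreathAut_coord_pair (Γ : Subgroup SL2) (n : ℕ) (g : Wreath Γ n) (i : Fin n) (b : Fin 2) :
    wreathAut Γ n g (coord (i, b)) =
      ∑ c, ((g⁻¹.left i : SL2) : Matrix (Fin 2) (Fin 2) ℂ) b c • coord (g.right i, c) := by
  rw [wreathAut_coord, Fintype.sum_prod_type, Finset.sum_eq_single (g.right i)]
  · simp [wreathMatrix, wreathMat]
  · intro k _ hk
    refine Finset.sum_eq_zero fun c _ => ?_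
    simp [wreathMatrix, wreathMat, hk.symm]
  · simp

theorem gammaAut_coord (Γ : Subgroup SL2) (g : Γ) (i : Fin 1) (b : Fin 2) :
    gammaAut Γ g (coord (i, b)) =
      ∑ c, (((g : SL2)⁻¹ : SL2) : Matrix (Fin 2) (Fin 2) ℂ) b c • coord (i, c) := by
  rw [gammaAut, MonoidHom.comp_apply, wreathAut_coord_pair]
  refine Finset.sum_congr rfl fun c _ => ?_
  congr 1

theorem gammaAut_isPoissonAut (Γ : Subgroup SL2) (g : Γ) : IsPoissonAut (gammaAut Γ g) :=
  wreathAut_isPoissonAut Γ 1 _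

theorem mem_KGamma {Γ : Subgroup SL2} {f : K 1} :
    f ∈ KGamma Γ ↔ ∀ g, gammaAut Γ g f = f := by
  rw [IntermediateField.mem_fixedField_iff]
  exact ⟨fun h g => h _ ⟨g, rfl⟩, by rintro h _ ⟨g, rfl⟩; exact h g⟩

theorem gammaAut_x (Γ : Subgroup SL2) (g : Γ) :
    gammaAut Γ g (x 0) = (g : SL2) 1 1 • x 0 - (g : SL2) 0 1 • y 0 := by
  rw [x, gammaAut_coord, Fin.sum_univ_two, Matrix.SpecialLinearGroup.coe_inv,
    Matrix.adjugate_fin_two]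
  simp [y, sub_eq_add_neg]

theorem gammaAut_y (Γ : Subgroup SL2) (g : Γ) :
    gammaAut Γ g (y 0) = (g : SL2) 0 0 • y 0 - (g : SL2) 1 0 • x 0 := by
  rw [y, gammaAut_coord, Fin.sum_univ_two, Matrix.SpecialLinearGroup.coe_inv,
    Matrix.adjugate_fin_two]
  simp [x, sub_eq_neg_add]

theorem partialD_zero_x : partialD (0, 0) (x 0 : K 1) = 1 := by simp [x, partialD_coord]
theorem partialD_zero_y : partialD (0, 0) (y 0 : K 1) = 0 := by simp [y, partialD_coord]
theorem partialD_one_x : partialD (0, 1) (x 0 : K 1) = 0 := by simp [x, partialD_coord]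
theorem partialD_one_y : partialD (0, 1) (y 0 : K 1) = 1 := by simp [y, partialD_coord]

theorem x_ne_zero : (x 0 : K 1) ≠ 0 := by
  intro h
  have := partialD_zero_x
  rw [h, map_zero] at this
  exact zero_ne_one this

theorem bracket_one (f g : K 1) : bracket f g =
    partialD (0, 0) f * partialD (0, 1) g - partialD (0, 1) f * partialD (0, 0) g := by
  simp [bracket]

theorem linearForm_injective {a b c d : ℂ}
    (h : a • (x 0 : K 1) + b • y 0 = c • x 0 + d • y 0) : a = c ∧ b = d := by
  have h0 := congrArg (partialD (0, 0)) h
  have h1 := congrArg (partialD (0, 1)) h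
  simp only [map_add, Derivation.map_smul, partialD_zero_x, partialD_zero_y, partialD_one_x,
    partialD_one_y, smul_zero, add_zero, zero_add] at h0 h1
  simp only [Algebra.smul_def, mul_one] at h0 h1
  exact ⟨(algebraMap ℂ (K 1)).injective h0, (algebraMap ℂ (K 1)).injective h1⟩

theorem gammaAut_injective (Γ : Subgroup SL2) : Function.Injective (gammaAut Γ) := by
  intro g h hgh
  have hx := DFunLike.congr_fun hgh (x 0)
  have hy := DFunLike.congr_fun hgh (y 0)
  rw [gammaAut_x, gammaAut_x, sub_eq_add_neg, sub_eq_add_neg, ← neg_smul, ← neg_smul] at hx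
  rw [gammaAut_y, gammaAut_y, sub_eq_neg_add, sub_eq_neg_add, ← neg_smul, ← neg_smul] at hy
  obtain ⟨h11, h01⟩ := linearForm_injective hx
  obtain ⟨h10, h00⟩ := linearForm_injective hy
  apply Subtype.ext
  ext i j
  fin_cases i <;> fin_cases j
  · exact h00
  · exact neg_injective h01
  · exact neg_injective h10
  · exact h11

theorem algHom_ext_xy {B : Type*} [Semiring B] [Algebra ℂ B] {f g : K 1 →ₐ[ℂ] B}
    (hx : f (x 0) = g (x 0)) (hy : f (y 0) = g (y 0)) : f = g := by
  apply algHom_ext_coord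
  rintro ⟨i, b⟩
  obtain rfl := Subsingleton.elim i 0
  fin_cases b
  · exact hx
  · exact hy

open Polynomial in
theorem prod_orbit_map (Γ : Subgroup SL2) [Fintype Γ] (f : K 1) (h : Γ) :
    (∏ g, (X - C (gammaAut Γ g f))).map (gammaAut Γ h : K 1 →+* K 1) =
      ∏ g, (X - C (gammaAut Γ g f)) := by
  rw [Polynomial.map_prod]
  refine Fintype.prod_equiv (Equiv.mulLeft h) _ _ fun g => ?_
  simp

open Polynomial in
theorem coeff_prod_orbit_mem (Γ : Subgroup SL2) [Fintype Γ] (f : K 1) (m : ℕ) :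
    (∏ g, (X - C (gammaAut Γ g f))).coeff m ∈ KGamma Γ := by
  rw [mem_KGamma]
  intro h
  conv_rhs => rw [← prod_orbit_map Γ f h, coeff_map]
  rfl

open Polynomial in
theorem coeff_prod_mem {k E ι : Type*} [Field k] [Field E] [Algebra k E] [Fintype ι]
    (M : IntermediateField k E) (s : ι → E) (hs : ∀ i, s i ∈ M) (m : ℕ) :
    (∏ i, (X - C (s i))).coeff m ∈ M := by
  have : (∏ i, (X - C (s i))) = (∏ i, (X - C (⟨s i, hs i⟩ : M))).map (algebraMap M E) := by
    rw [Polynomial.map_prod]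
    refine Finset.prod_congr rfl fun i _ => ?_
    simp
  rw [this, coeff_map]
  exact Subtype.property _

/-- Homomorphisms agreeing on the invariants differ by an element of `Γ`. -/
theorem exists_gammaAut_of_eqOn (Γ : Subgroup SL2) [Finite Γ] {Ω : Type*} [Field Ω] [Algebra ℂ Ω]
    (σ j : K 1 →ₐ[ℂ] Ω) (h : ∀ f ∈ KGamma Γ, σ f = j f) :
    ∃ g : Γ, ∀ f, σ f = j (gammaAut Γ g f) := by
  have := Fintype.ofFinite Γ
  have key : ∀ f, ∃ g, σ f = j (gammaAut Γ g f) := by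
    intro f
    obtain ⟨g, hg⟩ := exists_map_eq_of_prod_map_eq (σ : K 1 →+* Ω) (j : K 1 →+* Ω)
      (fun g : Γ => gammaAut Γ g f) (by
        ext m
        rw [Polynomial.coeff_map, Polynomial.coeff_map]
        exact h _ (coeff_prod_orbit_mem Γ f m)) 1
    rw [map_one] at hg
    exact ⟨g, hg⟩
  -- The group element found in `key` depends on `f`. Among the infinitely many forms x + c y two
  -- share the same one, and these two span all linear forms.
  choose γ hγ using fun c : ℂ => key (x 0 + c • y 0)
  obtain ⟨c, d, hcd, he⟩ := Finite.exists_ne_map_eq_of_infinite γ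
  refine ⟨γ c, ?_⟩
  have h1 := hγ c
  have h2 := hγ d
  rw [← he] at h2
  simp only [Algebra.smul_def, map_add, map_mul, AlgEquiv.commutes, AlgHom.commutes] at h1 h2
  have hy : σ (y 0) = j (gammaAut Γ (γ c) (y 0)) := by
    have : (c - d) • σ (y 0) = (c - d) • j (gammaAut Γ (γ c) (y 0)) := by
      rw [sub_smul, sub_smul]
      simp only [Algebra.smul_def]
      linear_combination h1 - h2
    exact (smul_right_inj (sub_ne_zero.mpr hcd)).mp this
  have hx : σ (x 0) = j (gammaAut Γ (γ c) (x 0)) := by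
    rw [hy] at h1
    exact add_right_cancel h1
  have : σ = j.comp (gammaAut Γ (γ c)).toAlgHom := algHom_ext_xy hx hy
  exact fun f => DFunLike.congr_fun this f

/-! ### Canonical pairs -/

theorem isCanonical_pair {u v : K 1} (h : bracket u v = 1) :
    IsCanonical (fun p : Fin 1 × Fin 2 => (![u, v] : Fin 2 → K 1) p.2) := by
  rintro ⟨i, b⟩ ⟨j, c⟩
  obtain rfl := Subsingleton.elim i 0
  obtain rfl := Subsingleton.elim j 0
  have h0 : ∀ f : K 1, bracket f f = 0 := PoissonAlgebra.pb_self (R := ℂ)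
  fin_cases b <;> fin_cases c
  · simp [h0]
  · simp [h, bracket_coord_one, partialD_coord]
  · simp only [Fin.mk_one, Matrix.cons_val_one, Fin.zero_eta, Matrix.cons_val_zero,
      bracket_coord_zero, partialD_coord, if_true]
    rw [bracket_skew]
    simp [h]
  · simp [h0]

/-- The case n = 1 of the embedding criterion, to which both explicit forms are reduced. -/
theorem isCanonicalPair_of_embeddings (Γ : Subgroup SL2) {u v : K 1} (hu : u ∈ KGamma Γ)
    (hv : v ∈ KGamma Γ) (h : bracket u v = 1)
    (hτ : ∀ τ : K 1 →ₐ[ℂ] AlgebraicClosure (K 1), τ u = incl 1 u → τ v = incl 1 v →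
      ∃ g : Γ, τ (x 0) = incl 1 (gammaAut Γ g (x 0)) ∧ τ (y 0) = incl 1 (gammaAut Γ g (y 0))) :
    IsCanonicalPair Γ u v := by
  have hc := isCanonical_pair h
  obtain ⟨e, he⟩ := hc.exists_equiv (gammaAut Γ).range
    (by rintro _ ⟨g, rfl⟩; exact gammaAut_isPoissonAut Γ g)
    (hc.adjoin_eq_fixedField _ (by
      rintro ⟨i, b⟩
      fin_cases b
      · exact hu
      · exact hv) (by
      intro τ h
      obtain ⟨g, hx, hy⟩ := hτ τ (h (0, 0)) (h (0, 1))
      refine ⟨_, ⟨g, rfl⟩, ?_⟩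
      rintro ⟨i, b⟩
      obtain rfl := Subsingleton.elim i 0
      fin_cases b
      · exact hx
      · exact hy))
  exact ⟨e, he (0, 0), he (0, 1)⟩

theorem IsCanonicalPair.mem {Γ : Subgroup SL2} {u v : K 1} (h : IsCanonicalPair Γ u v) :
    u ∈ KGamma Γ ∧ v ∈ KGamma Γ := by
  obtain ⟨e, rfl, rfl⟩ := h
  exact ⟨Subtype.property _, Subtype.property _⟩

theorem IsCanonicalPair.bracket_eq {Γ : Subgroup SL2} {u v : K 1} (h : IsCanonicalPair Γ u v) :
    bracket u v = 1 := by
  obtain ⟨e, rfl, rfl⟩ := h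
  have h1 := e.map_pb (e.toAlgEquiv.symm (x 0)) (e.toAlgEquiv.symm (y 0))
  rw [AlgEquiv.apply_symm_apply, AlgEquiv.apply_symm_apply] at h1
  have h2 : PoissonAlgebra.pb ℂ (x 0 : K 1) (y 0) = 1 := by
    change bracket _ _ = _
    simp [x, y, bracket_coord_one, partialD_coord]
  rw [h2, ← map_one e.toAlgEquiv] at h1
  exact congrArg Subtype.val (e.toAlgEquiv.injective h1)

/-- Homomorphisms agreeing on a canonical pair agree on the invariants. -/
theorem IsCanonicalPair.eqOn {Γ : Subgroup SL2} {u v : K 1} (h : IsCanonicalPair Γ u v)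
    {Ω : Type*} [Field Ω] [Algebra ℂ Ω] {σ j : K 1 →ₐ[ℂ] Ω} (hu : σ u = j u) (hv : σ v = j v)
    (f : K 1) (hf : f ∈ KGamma Γ) : σ f = j f := by
  obtain ⟨e, rfl, rfl⟩ := h
  have : (σ.comp (KGamma Γ).val).comp e.toAlgEquiv.symm.toAlgHom =
      (j.comp (KGamma Γ).val).comp e.toAlgEquiv.symm.toAlgHom := algHom_ext_xy hu hv
  have := DFunLike.congr_fun this (e.toAlgEquiv ⟨f, hf⟩)
  simpa using this

/-! ### Pairs of eigenforms -/

theorem bracket_linearForm (α β γ δ : ℂ) :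
    bracket (α • x 0 + β • y 0 : K 1) (γ • x 0 + δ • y 0) =
      algebraMap ℂ (K 1) (α * δ - β * γ) := by
  rw [bracket_one]
  simp only [map_add, Derivation.map_smul, partialD_zero_x, partialD_zero_y, partialD_one_x,
    partialD_one_y, smul_zero, add_zero, zero_add]
  simp only [Algebra.smul_def, mul_one, map_sub, map_mul]

theorem algHom_ext_linearForms {B : Type*} [CommRing B] [Algebra ℂ B] {f g : K 1 →ₐ[ℂ] B}
    {l₁ l₂ : K 1} (h₁ : ∃ α β : ℂ, l₁ = α • x 0 + β • y 0)
    (h₂ : ∃ α β : ℂ, l₂ = α • x 0 + β • y 0) (h : bracket l₁ l₂ = 1) (e₁ : f l₁ = g l₁)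
    (e₂ : f l₂ = g l₂) : f = g := by
  obtain ⟨α, β, rfl⟩ := h₁
  obtain ⟨γ, δ, rfl⟩ := h₂
  rw [bracket_linearForm] at h
  simp only [Algebra.smul_def, map_add, map_mul, AlgHom.commutes] at e₁ e₂
  have h' := congrArg (algebraMap ℂ B) (show α * δ - β * γ = 1 from
    (algebraMap ℂ (K 1)).injective (by rw [h, map_one]))
  simp only [map_sub, map_mul, map_one] at h'
  apply algHom_ext_xy
  · linear_combination algebraMap ℂ B δ * e₁ - algebraMap ℂ B β * e₂ - f (x 0) * h' +
      g (x 0) * h'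
  · linear_combination algebraMap ℂ B α * e₂ - algebraMap ℂ B γ * e₁ - f (y 0) * h' +
      g (y 0) * h'

/-- Γ acts on l₁ and l₂ by characters a and c with a c = 1, so c is faithful and, by counting, takes
every m-th root of unity as a value. An embedding fixing l₂^m therefore acts on l₂ as some g does;
fixing u, it also acts so on l₁ = m u l₂^(m-1). -/
theorem isCanonicalPair_cyclic (Γ : Subgroup SL2) [Finite Γ] {l₁ l₂ : K 1}
    (h₁ : IsEigenform Γ l₁) (h₂ : IsEigenform Γ l₂) (h : bracket l₁ l₂ = 1) :
    IsCanonicalPair Γ (l₁ / ((Nat.card Γ : K 1) * l₂ ^ (Nat.card Γ - 1))) (l₂ ^ Nat.card Γ) := by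
  classical
  obtain ⟨hl₁, h₁⟩ := h₁
  obtain ⟨hl₂, h₂⟩ := h₂
  choose a ha using h₁
  choose c hc using h₂
  have hl0 : l₂ ≠ 0 := by
    rintro rfl
    rw [← ham_apply, map_zero] at h
    exact zero_ne_one h
  have hac : ∀ g, a g * c g = 1 := by
    intro g
    have hb := gammaAut_isPoissonAut Γ g l₁ l₂
    rw [h, map_one, ha, hc, ← ham_apply, Derivation.map_smul, ham_apply, bracket_skew,
      ← ham_apply, Derivation.map_smul, ham_apply, ← smul_neg, ← bracket_skew, h, smul_smul,
      Algebra.smul_def, mul_one, eq_comm, ← map_one (algebraMap ℂ (K 1))] at hb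
    rw [mul_comm]
    exact (algebraMap ℂ (K 1)).injective hb
  have hcp : ∀ g, c g ^ Nat.card Γ = 1 := by
    intro g
    have hk : ∀ k : ℕ, gammaAut Γ (g ^ k) l₂ = c g ^ k • l₂ := by
      intro k
      induction k with
      | zero => simp
      | succ k ih =>
        rw [pow_succ, map_mul, AlgEquiv.mul_apply, hc, Algebra.smul_def, map_mul,
          AlgEquiv.commutes, ih, ← Algebra.smul_def, smul_smul, pow_succ, mul_comm]
    have := hk (Nat.card Γ)
    rw [pow_card_eq_one', map_one, AlgEquiv.one_apply] at this
    exact (smul_left_injective ℂ hl0 (by simpa using this)).symm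
  set m := Nat.card Γ with hm
  have hm1 : m = m - 1 + 1 := by
    have : 0 < m := Nat.card_pos
    omega
  have hm0 : (m : K 1) ≠ 0 := by
    rw [hm1]
    exact Nat.cast_add_one_ne_zero _
  set u := l₁ / ((m : K 1) * l₂ ^ (m - 1)) with hu
  have hl1 : l₁ = m * u * l₂ ^ (m - 1) := by
    rw [hu]
    field_simp
  have hinv2 : ∀ g, gammaAut Γ g (l₂ ^ m) = l₂ ^ m := by
    intro g
    rw [map_pow, hc, smul_pow, hcp, one_smul]
  have hinv1 : ∀ g, gammaAut Γ g u = u := by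
    intro g
    have hcg : algebraMap ℂ (K 1) (c g) ≠ 0 := by
      rw [Ne, map_eq_zero]
      exact right_ne_zero_of_mul_eq_one (hac g)
    rw [hu, map_div₀, map_mul, map_pow, map_natCast, ha, hc, Algebra.smul_def, Algebra.smul_def,
      mul_pow, div_eq_div_iff (by positivity) (by positivity)]
    have e1 := congrArg (algebraMap ℂ (K 1)) (hac g)
    have e2 := congrArg (algebraMap ℂ (K 1)) (hcp g)
    rw [hm1, pow_succ] at e2
    simp only [map_mul, map_pow, map_one] at e1 e2
    -- The extra factor c turns c^(m-1) into c^m = 1.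
    apply mul_left_cancel₀ hcg
    linear_combination (l₁ * m * l₂ ^ (m - 1)) * e1 - (l₁ * m * l₂ ^ (m - 1)) * e2
  apply isCanonicalPair_of_embeddings Γ (mem_KGamma.mpr hinv1) (mem_KGamma.mpr hinv2)
  · have hp : bracket l₁ (l₂ ^ m) = m * l₂ ^ (m - 1) := by
      rw [← ham_apply, Derivation.leibniz_pow, ham_apply, h]
      simp
    have hp2 : bracket (l₂ ^ m) (l₂ ^ (m - 1)) = 0 := by
      rw [← ham_apply, Derivation.leibniz_pow, ham_apply, bracket_skew, ← ham_apply,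
        Derivation.leibniz_pow, ham_apply,
        show bracket l₂ l₂ = 0 from PoissonAlgebra.pb_self (R := ℂ) l₂]
      simp
    -- Expanding {v, l₁} in two ways, with l₁ = m u l₂^(m-1) and {v, l₂^(m-1)} = 0, isolates {u, v}.
    have hp3 : bracket (l₂ ^ m) l₁ = bracket (l₂ ^ m) (m * u * l₂ ^ (m - 1)) := by rw [← hl1]
    rw [← ham_apply, ← ham_apply, Derivation.leibniz, Derivation.leibniz, ham_apply, ham_apply,
      ham_apply, ham_apply, hp2, bracket_skew _ l₁, hp, bracket_skew _ u, ← ham_apply (l₂ ^ m),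
      Derivation.map_natCast] at hp3
    simp only [smul_eq_mul, mul_zero, zero_add, add_zero] at hp3
    have hne : (m : K 1) * l₂ ^ (m - 1) ≠ 0 := mul_ne_zero hm0 (pow_ne_zero _ hl0)
    apply mul_left_cancel₀ hne
    linear_combination hp3
  · intro τ hτu hτv
    have hinj : Function.Injective fun g => algebraMap ℂ (AlgebraicClosure (K 1)) (c g) := by
      intro g g' hgg
      have hcc : c g = c g' := (algebraMap ℂ _).injective hgg
      apply gammaAut_injective Γ
      have : (gammaAut Γ g).toAlgHom = (gammaAut Γ g').toAlgHom := by
        apply algHom_ext_linearForms hl₁ hl₂ h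
        · change gammaAut Γ g l₁ = gammaAut Γ g' l₁
          have hag : a g = a g' := by
            have h1 := hac g
            have h2 := hac g'
            rw [← hcc] at h2
            exact mul_right_cancel₀ (right_ne_zero_of_mul_eq_one h1) (h1.trans h2.symm)
          rw [ha, ha, hag]
        · change gammaAut Γ g l₂ = gammaAut Γ g' l₂
          rw [hc, hc, hcc]
      exact AlgEquiv.ext fun f => DFunLike.congr_fun this f
    have hι0 : incl 1 l₂ ≠ 0 := by
      rw [Ne, map_eq_zero]
      exact hl0
    have := Fintype.ofFinite Γ
    have himg : Finset.univ.image (fun g => algebraMap ℂ (AlgebraicClosure (K 1)) (c g)) =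
        Polynomial.nthRootsFinset m (1 : AlgebraicClosure (K 1)) := by
      apply Finset.eq_of_subset_of_card_le
      · intro z hz
        obtain ⟨g, -, rfl⟩ := Finset.mem_image.mp hz
        rw [Polynomial.mem_nthRootsFinset (by omega), ← map_pow, hcp, map_one]
      · rw [Finset.card_image_of_injective _ hinj, Finset.card_univ, ← Nat.card_eq_fintype_card]
        refine (Multiset.toFinset_card_le _).trans ?_
        exact Polynomial.card_nthRoots m 1
    have hz : τ l₂ / incl 1 l₂ ∈ Polynomial.nthRootsFinset m (1 : AlgebraicClosure (K 1)) := by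
      rw [Polynomial.mem_nthRootsFinset (by omega), div_pow, ← map_pow, ← map_pow, hτv, div_self]
      rw [map_pow]
      exact pow_ne_zero _ hι0
    rw [← himg] at hz
    obtain ⟨g, -, hg⟩ := Finset.mem_image.mp hz
    have e2 : τ l₂ = incl 1 (gammaAut Γ g l₂) := by
      rw [hc, Algebra.smul_def, map_mul, AlgHom.commutes, hg, div_mul_cancel₀ _ hι0]
    have e1 : τ l₁ = incl 1 (gammaAut Γ g l₁) := by
      rw [hl1]
      simp only [map_mul, map_pow, map_natCast, hτu, e2, hinv1]
    have : τ = (incl 1).comp (gammaAut Γ g).toAlgHom := algHom_ext_linearForms hl₁ hl₂ h e1 e2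
    exact ⟨g, DFunLike.congr_fun this _, DFunLike.congr_fun this _⟩

/-! ### Functions of `t = y / x` -/

theorem ratio_mul_x : ratio * x 0 = y 0 := div_mul_cancel₀ _ x_ne_zero

theorem x_mul_partialD_one_ratio : x 0 * partialD (0, 1) ratio = 1 := by
  have h := congrArg (partialD (0, 1)) ratio_mul_x
  rw [Derivation.leibniz, partialD_one_x, partialD_one_y, smul_zero, zero_add, smul_eq_mul] at h
  exact h

theorem x_mul_partialD_zero_ratio : x 0 * partialD (0, 0) ratio = -ratio := by
  have h := congrArg (partialD (0, 0)) ratio_mul_x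
  rw [Derivation.leibniz, partialD_zero_x, partialD_zero_y, smul_eq_mul, smul_eq_mul] at h
  linear_combination h

/-- Functions of `t` are homogeneous of degree zero. -/
theorem euler_of_mem_adjoin_ratio {f : K 1} (hf : f ∈ IntermediateField.adjoin ℂ {ratio}) :
    partialD (0, 0) f = -ratio * partialD (0, 1) f := by
  have hle : IntermediateField.adjoin ℂ {ratio} ≤
      derivKer (partialD (0, 0) + ratio • partialD (0, 1) : Derivation ℂ (K 1) (K 1)) := by
    rw [IntermediateField.adjoin_le_iff, Set.singleton_subset_iff]
    change partialD (0, 0) ratio + ratio * partialD (0, 1) ratio = 0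
    apply mul_left_cancel₀ x_ne_zero
    linear_combination x_mul_partialD_zero_ratio + ratio * x_mul_partialD_one_ratio
  have := hle hf
  change partialD (0, 0) f + ratio * partialD (0, 1) f = 0 at this
  linear_combination this

theorem derivation_mem_adjoin {k E : Type*} [Field k] [Field E] [Algebra k E] {S : Set E}
    {D : Derivation k E E} (hD : ∀ t ∈ S, D t ∈ IntermediateField.adjoin k S) {f : E}
    (hf : f ∈ IntermediateField.adjoin k S) : D f ∈ IntermediateField.adjoin k S := by
  induction hf using IntermediateField.adjoin_induction with
  | mem f hf => exact hD f hf
  | algebraMap c => rw [Derivation.map_algebraMap]; exact zero_mem _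
  | add f g _ _ hf hg => rw [map_add]; exact add_mem hf hg
  | inv f h hf =>
    rw [Derivation.leibniz_inv]
    exact mul_mem (neg_mem (pow_mem (inv_mem h) 2)) hf
  | mul f g h h' hf hg =>
    rw [Derivation.leibniz]
    exact add_mem (mul_mem h hg) (mul_mem h' hf)

theorem eqOn_adjoin {k E B : Type*} [Field k] [Field E] [Algebra k E] [Field B] [Algebra k B]
    {σ τ : E →ₐ[k] B} {S : Set E} (h : ∀ t ∈ S, σ t = τ t) {f : E}
    (hf : f ∈ IntermediateField.adjoin k S) : σ f = τ f := by
  induction hf using IntermediateField.adjoin_induction with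
  | mem f hf => exact h f hf
  | algebraMap c => rw [AlgHom.commutes, AlgHom.commutes]
  | add f g _ _ hf hg => rw [map_add, map_add, hf, hg]
  | inv f _ hf => rw [map_inv₀, map_inv₀, hf]
  | mul f g _ _ hf hg => rw [map_mul, map_mul, hf, hg]

theorem gammaAut_x_eq (Γ : Subgroup SL2) (g : Γ) : gammaAut Γ g (x 0) =
    (algebraMap ℂ (K 1) ((g : SL2) 1 1) - algebraMap ℂ (K 1) ((g : SL2) 0 1) * ratio) * x 0 := by
  rw [gammaAut_x, Algebra.smul_def, Algebra.smul_def]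
  linear_combination algebraMap ℂ (K 1) ((g : SL2) 0 1) * ratio_mul_x

theorem gammaAut_y_eq (Γ : Subgroup SL2) (g : Γ) : gammaAut Γ g (y 0) =
    (algebraMap ℂ (K 1) ((g : SL2) 0 0) * ratio - algebraMap ℂ (K 1) ((g : SL2) 1 0)) * x 0 := by
  rw [gammaAut_y, Algebra.smul_def, Algebra.smul_def]
  linear_combination -algebraMap ℂ (K 1) ((g : SL2) 0 0) * ratio_mul_x

theorem denom_ne_zero (Γ : Subgroup SL2) (g : Γ) :
    algebraMap ℂ (K 1) ((g : SL2) 1 1) - algebraMap ℂ (K 1) ((g : SL2) 0 1) * ratio ≠ 0 := by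
  intro h
  have h1 := gammaAut_x_eq Γ g
  rw [h, zero_mul, map_eq_zero_iff _ (gammaAut Γ g).injective] at h1
  exact x_ne_zero h1

theorem gammaAut_ratio (Γ : Subgroup SL2) (g : Γ) : gammaAut Γ g ratio =
    (algebraMap ℂ (K 1) ((g : SL2) 0 0) * ratio - algebraMap ℂ (K 1) ((g : SL2) 1 0)) /
      (algebraMap ℂ (K 1) ((g : SL2) 1 1) - algebraMap ℂ (K 1) ((g : SL2) 0 1) * ratio) := by
  conv_lhs => rw [ratio, map_div₀, gammaAut_y_eq, gammaAut_x_eq]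
  exact mul_div_mul_right _ _ x_ne_zero

theorem ratio_mem : ratio ∈ IntermediateField.adjoin ℂ {ratio} :=
  IntermediateField.mem_adjoin_simple_self ℂ ratio

theorem gammaAut_ratio_mem (Γ : Subgroup SL2) (g : Γ) :
    gammaAut Γ g ratio ∈ IntermediateField.adjoin ℂ {ratio} := by
  rw [gammaAut_ratio]
  exact div_mem (sub_mem (mul_mem (IntermediateField.algebraMap_mem _ _) ratio_mem)
    (IntermediateField.algebraMap_mem _ _)) (sub_mem (IntermediateField.algebraMap_mem _ _)
    (mul_mem (IntermediateField.algebraMap_mem _ _) ratio_mem))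

open Polynomial in
theorem coeff_prod_orbit_ratio_mem (Γ : Subgroup SL2) [Fintype Γ] (m : ℕ) :
    (∏ g, (X - C (gammaAut Γ g ratio))).coeff m ∈ ratioInvariants Γ :=
  ⟨coeff_prod_mem _ _ (gammaAut_ratio_mem Γ) m, coeff_prod_orbit_mem Γ ratio m⟩

theorem gammaAut_neg_one_coord (Γ : Subgroup SL2) (hΓ : (-1 : SL2) ∈ Γ) :
    gammaAut Γ ⟨-1, hΓ⟩ (x 0) = -x 0 ∧ gammaAut Γ ⟨-1, hΓ⟩ (y 0) = -y 0 := by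
  rw [gammaAut_x, gammaAut_y]
  simp

/-- Otherwise ∂/∂y kills all of ℂ(t)^Γ, hence also t, a root of the orbit polynomial; but x ∂t/∂y =
1. -/
theorem partialD_ne_zero_of_generator (Γ : Subgroup SL2) [Finite Γ] {v : K 1}
    (hv : IntermediateField.adjoin ℂ {v} = ratioInvariants Γ) : partialD (0, 1) v ≠ 0 := by
  intro h0
  have := Fintype.ofFinite Γ
  have hle : ratioInvariants Γ ≤ derivKer (partialD (0, 1) : Derivation ℂ (K 1) (K 1)) := by
    rw [← hv, IntermediateField.adjoin_le_iff, Set.singleton_subset_iff]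
    exact h0
  have h1 := derivation_eq_zero_of_prod (D := (partialD (0, 1) : Derivation ℂ (K 1) (K 1)))
    (fun g : Γ => gammaAut Γ g ratio) (fun m => hle (coeff_prod_orbit_ratio_mem Γ m)) 1
  rw [map_one, AlgEquiv.one_apply] at h1
  have h2 := x_mul_partialD_one_ratio
  rw [h1, mul_zero] at h2
  exact zero_ne_one h2

/-- Write w = ∂v/∂y = {x, v}, so that x = 2 u w. Each g multiplies x and w by the same factor g₂₂ -
g₁₂ t, hence fixes u. An embedding fixing u and v acts on t as some g does, so also on dv/dt ∈ ℂ(t),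
and therefore on x² = 2 u dv/dt. -/
theorem isCanonicalPair_even (Γ : Subgroup SL2) [Finite Γ] {v : K 1} (hΓ : (-1 : SL2) ∈ Γ)
    (hv : IntermediateField.adjoin ℂ {v} = ratioInvariants Γ) :
    IsCanonicalPair Γ (x 0 ^ 2 / (2 * (x 0 * partialD (0, 1) v))) v := by
  have hv0 := partialD_ne_zero_of_generator Γ hv
  have hvm : v ∈ ratioInvariants Γ := hv ▸ IntermediateField.mem_adjoin_simple_self ℂ v
  obtain ⟨hvt, hvΓ⟩ := hvm
  have hx0 := x_ne_zero
  have heul := euler_of_mem_adjoin_ratio hvt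
  set w := partialD (0, 1) v with hw
  set u := x 0 ^ 2 / (2 * (x 0 * w)) with hu
  have hux : 2 * u * w = x 0 := by
    rw [hu]
    field_simp
  have hux2 : x 0 ^ 2 = 2 * u * (x 0 * w) := by linear_combination -x 0 * hux
  clear_value u w
  have hbx : bracket (x 0) v = w := by
    rw [bracket_one, partialD_zero_x, partialD_one_x, one_mul, zero_mul, sub_zero, hw]
  have hinv : ∀ g, gammaAut Γ g u = u := by
    intro g
    have hgw : gammaAut Γ g w = (algebraMap ℂ (K 1) ((g : SL2) 1 1) -
        algebraMap ℂ (K 1) ((g : SL2) 0 1) * ratio) * w := by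
      rw [← hbx, gammaAut_isPoissonAut, mem_KGamma.mp hvΓ, gammaAut_x, bracket_one, heul]
      simp only [map_sub, Derivation.map_smul, partialD_zero_x, partialD_zero_y, partialD_one_x,
        partialD_one_y, smul_zero, sub_zero, zero_sub]
      simp only [Algebra.smul_def]
      rw [hbx, ← hw]
      ring
    have h1 := congrArg (gammaAut Γ g) hux
    rw [map_mul, map_mul, map_ofNat, hgw, gammaAut_x_eq, ← hux] at h1
    have := denom_ne_zero Γ g
    apply mul_left_cancel₀ (mul_ne_zero two_ne_zero (mul_ne_zero this hv0))
    linear_combination h1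
  apply isCanonicalPair_of_embeddings Γ (mem_KGamma.mpr hinv) hvΓ
  · have h0 := congrArg (partialD (0, 0)) hux
    have h1 := congrArg (partialD (0, 1)) hux
    have hw0 : partialD (0, 0) w = -(ratio * partialD (0, 1) w + w * partialD (0, 1) ratio) := by
      rw [hw, partialD_comm, heul, ← hw]
      simp only [Derivation.leibniz, map_neg, smul_eq_mul]
      ring
    have h2 : ∀ D : Derivation ℂ (K 1) (K 1), D 2 = 0 := fun D => by
      exact_mod_cast D.map_natCast 2
    simp only [Derivation.leibniz, h2, smul_eq_mul, partialD_zero_x,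
      partialD_one_x, hw0, mul_zero, add_zero] at h0 h1
    rw [bracket_one, heul, ← hw]
    have ht := x_mul_partialD_one_ratio
    apply mul_left_cancel₀ (two_ne_zero (α := K 1))
    linear_combination h0 + ratio * h1 + ht + partialD (0, 1) ratio * hux
  · intro τ hτu hτv
    have := Fintype.ofFinite Γ
    obtain ⟨g, hg⟩ := exists_map_eq_of_prod_map_eq (τ : K 1 →+* AlgebraicClosure (K 1))
      (incl 1 : K 1 →+* AlgebraicClosure (K 1)) (fun g : Γ => gammaAut Γ g ratio) (by
        ext m
        rw [Polynomial.coeff_map, Polynomial.coeff_map]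
        exact eqOn_adjoin (by rintro _ rfl; exact hτv) (hv ▸ coeff_prod_orbit_ratio_mem Γ m)) 1
    rw [map_one, AlgEquiv.one_apply] at hg
    change τ ratio = incl 1 (gammaAut Γ g ratio) at hg
    have hD : x 0 * w ∈ IntermediateField.adjoin ℂ {ratio} := by
      have := derivation_mem_adjoin (D := (x 0 : K 1) • partialD (0, 1))
        (S := {ratio}) (by
          rintro _ rfl
          change (x 0 : K 1) * partialD (0, 1) ratio ∈ IntermediateField.adjoin ℂ {ratio}
          rw [x_mul_partialD_one_ratio]
          exact one_mem _) hvt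
      rw [hw]
      exact this
    have hgw : τ (x 0 * w) = incl 1 (gammaAut Γ g (x 0 * w)) :=
      eqOn_adjoin (τ := (incl 1).comp (gammaAut Γ g).toAlgHom)
        (by rintro _ rfl; exact hg) hD
    have hsq : τ (x 0) ^ 2 = incl 1 (gammaAut Γ g (x 0)) ^ 2 := by
      rw [← map_pow, ← map_pow, ← map_pow, hux2, map_mul τ, hgw]
      simp only [map_mul, map_ofNat, hτu, hinv]
    have hy : τ (y 0) = incl 1 (gammaAut Γ g ratio) * τ (x 0) := by
      rw [← ratio_mul_x, map_mul, hg]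
    -- With the minus sign, g is replaced by -g, which acts on t in the same way.
    rcases sq_eq_sq_iff_eq_or_eq_neg.mp hsq with h | h
    · refine ⟨g, h, ?_⟩
      rw [hy, h, ← map_mul, ← map_mul, ratio_mul_x]
    · obtain ⟨nx, ny⟩ := gammaAut_neg_one_coord Γ hΓ
      refine ⟨g * ⟨-1, hΓ⟩, ?_, ?_⟩
      · rw [h, map_mul, AlgEquiv.mul_apply, nx, map_neg, map_neg]
      · rw [hy, h, map_mul, AlgEquiv.mul_apply, ny, map_neg, map_neg, mul_neg, ← map_mul,
          ← map_mul, ratio_mul_x]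

theorem ExplicitPair.isCanonicalPair {Γ : Subgroup SL2} [Finite Γ] {u v : K 1}
    (h : ExplicitPair Γ u v) : IsCanonicalPair Γ u v := by
  cases h with
  | cyclic l₁ l₂ h₁ h₂ h => exact isCanonicalPair_cyclic Γ h₁ h₂ h
  | even v hΓ hv => exact isCanonicalPair_even Γ hΓ hv

/-! ### Generators of the invariant functions of `t = y / x` -/

theorem transcendental_ratio : Transcendental ℂ ratio := by
  intro h
  have h1 : partialD (0, 1) ratio = 0 := mem_derivKer_of_isAlgebraic
    (h.extendScalars (algebraMap ℂ (derivKer (partialD (0, 1)))).injective)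
  have h2 := x_mul_partialD_one_ratio
  rw [h1, mul_zero] at h2
  exact zero_ne_one h2

theorem finite_range_ratio (Γ : Subgroup SL2) [Finite Γ] :
    (Set.range fun g : Γ => gammaAut Γ g ratio).Finite := Set.finite_range _

theorem orbitProduct_eq (Γ : Subgroup SL2) [Finite Γ] (a : ℂ) : orbitProduct Γ a =
    ∏ s ∈ (finite_range_ratio Γ).toFinset, (s - algebraMap ℂ (K 1) a) :=
  finprod_mem_eq_finite_toFinset_prod _ _

theorem gammaAut_mem_orbit_iff (Γ : Subgroup SL2) [Finite Γ] (g : Γ) (s : K 1) :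
    s ∈ (finite_range_ratio Γ).toFinset ↔ gammaAut Γ g s ∈ (finite_range_ratio Γ).toFinset := by
  simp only [Set.Finite.mem_toFinset]
  constructor
  · rintro ⟨h, rfl⟩
    exact ⟨g * h, by simp only [map_mul, AlgEquiv.mul_apply]⟩
  · rintro ⟨h, hs⟩
    refine ⟨g⁻¹ * h, ?_⟩
    change gammaAut Γ h ratio = _ at hs
    change gammaAut Γ (g⁻¹ * h) ratio = s
    rw [map_mul, AlgEquiv.mul_apply, hs, ← AlgEquiv.mul_apply, ← map_mul, inv_mul_cancel, map_one,
      AlgEquiv.one_apply]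

theorem orbitProduct_mem (Γ : Subgroup SL2) [Finite Γ] (a : ℂ) :
    orbitProduct Γ a ∈ ratioInvariants Γ := by
  rw [orbitProduct_eq]
  constructor
  · refine prod_mem fun s hs => sub_mem ?_ (IntermediateField.algebraMap_mem _ _)
    obtain ⟨g, rfl⟩ := (Set.Finite.mem_toFinset _).mp hs
    exact gammaAut_ratio_mem Γ g
  · refine mem_KGamma.mpr fun g => ?_
    rw [map_prod]
    refine Finset.prod_equiv (gammaAut Γ g).toEquiv (gammaAut_mem_orbit_iff Γ g) fun s _ => ?_
    rw [map_sub, AlgEquiv.commutes]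
    rfl

/-- The minimal polynomial has invariant coefficients, so the whole orbit of t consists of roots. -/
theorem card_orbit_le_natDegree (Γ : Subgroup SL2) [Finite Γ]
    (ht : IsIntegral (ratioInvariants Γ) ratio) :
    (finite_range_ratio Γ).toFinset.card ≤ (minpoly (ratioInvariants Γ) ratio).natDegree := by
  rw [← Polynomial.natDegree_map (algebraMap (ratioInvariants Γ) (K 1))]
  apply Polynomial.card_le_degree_of_subset_roots
  intro s hs
  rw [Finset.mem_val, Set.Finite.mem_toFinset] at hs
  obtain ⟨g, rfl⟩ := hs
  rw [Polynomial.mem_roots (Polynomial.map_ne_zero (minpoly.ne_zero ht)), Polynomial.IsRoot.def,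
    Polynomial.eval_map]
  have h := congrArg (gammaAut Γ g : K 1 →+* K 1) (minpoly.aeval (ratioInvariants Γ) ratio)
  rw [Polynomial.aeval_def, Polynomial.hom_eval₂, map_zero] at h
  have hc : (gammaAut Γ g : K 1 →+* K 1).comp (algebraMap (ratioInvariants Γ) (K 1)) =
      algebraMap (ratioInvariants Γ) (K 1) :=
    RingHom.ext fun f => mem_KGamma.mp f.2.2 g
  rw [hc] at h
  exact h

-- With s - a = r_s(t) / d_s(t) on the orbit, t is a root of ∏ r_s - v ∏ d_s, so its degree over
-- ℂ(v) is at most the size of the orbit. Its degree over ℂ(t)^Γ is at least that size, and ℂ(v)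
-- lies in ℂ(t)^Γ.
open Polynomial in
theorem adjoin_orbitProduct (Γ : Subgroup SL2) [Finite Γ] (a : ℂ)
    (ha : ∀ g ∈ Γ, g.1 1 1 ≠ a * g.1 0 1) :
    IntermediateField.adjoin ℂ {orbitProduct Γ a} = ratioInvariants Γ := by
  have hmem := orbitProduct_mem Γ a
  set T := (finite_range_ratio Γ).toFinset with hT
  have hγ : ∀ s, ∃ g : Γ, s ∈ T → gammaAut Γ g ratio = s := by
    intro s
    by_cases hs : s ∈ T
    · obtain ⟨g, hg⟩ := (Set.Finite.mem_toFinset _).mp hs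
      exact ⟨g, fun _ => hg⟩
    · exact ⟨1, fun h => absurd h hs⟩
  choose γ hγ using hγ
  let d : K 1 → ℂ[X] := fun s => C ((γ s : SL2) 1 1) - C ((γ s : SL2) 0 1) * X
  let r : K 1 → ℂ[X] := fun s =>
    C ((γ s : SL2) 0 0) * X - C ((γ s : SL2) 1 0) - C a * d s
  have hdr : ∀ s ∈ T, aeval ratio (r s) = (s - algebraMap ℂ (K 1) a) * aeval ratio (d s) := by
    intro s hs
    have h1 := gammaAut_ratio Γ (γ s)
    rw [hγ s hs, eq_div_iff (denom_ne_zero Γ (γ s))] at h1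
    simp only [r, d, map_sub, map_mul, aeval_C, aeval_X]
    linear_combination -h1
  have hd1 : ∀ s, (d s).natDegree ≤ 1 := fun s => by
    simp only [d]
    compute_degree
  have hr1 : ∀ s, (r s).natDegree ≤ 1 := fun s => by
    simp only [r, d]
    compute_degree
  set v := orbitProduct Γ a with hv
  have hvT : v = ∏ s ∈ T, (s - algebraMap ℂ (K 1) a) := orbitProduct_eq Γ a
  have hv0 : v ≠ 0 := by
    rw [hvT, Finset.prod_ne_zero_iff]
    intro s hs h0
    obtain ⟨g, rfl⟩ := (Set.Finite.mem_toFinset _).mp hs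
    rw [sub_eq_zero, ← (gammaAut Γ g).commutes a] at h0
    apply transcendental_ratio
    rw [(gammaAut Γ g).injective h0]
    exact isAlgebraic_algebraMap a
  have htT : ratio ∈ T := (Set.Finite.mem_toFinset _).mpr ⟨1, by simp⟩
  -- The element chosen for s = t stabilises t but need not be 1; transcendence of t gives r_t = (X
  -- - a) d_t.
  have hra : (r ratio).eval a = 0 := by
    have h1 : r ratio - (X - C a) * d ratio = 0 := by
      by_contra hne
      refine transcendental_ratio ⟨_, hne, ?_⟩
      rw [map_sub, hdr ratio htT]
      simp
    rw [sub_eq_zero.mp h1]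
    simp
  set L := IntermediateField.adjoin ℂ {v} with hL
  let v' : L := ⟨v, IntermediateField.mem_adjoin_simple_self ℂ v⟩
  let p : L[X] := (∏ s ∈ T, r s).map (algebraMap ℂ L) - C v' * (∏ s ∈ T, d s).map (algebraMap ℂ L)
  have hp0 : p ≠ 0 := by
    -- At X = a the first product vanishes, while v ∏ d_s(a) does not: d_s(a) ≠ 0 is the genericity
    -- of `a`.
    intro h
    have h1 := congrArg (eval (algebraMap ℂ L a)) h
    simp only [p, eval_sub, eval_mul, eval_C, eval_map_apply, eval_zero, eval_prod] at h1
    rw [Finset.prod_eq_zero htT hra, map_zero, zero_sub, neg_eq_zero, mul_eq_zero,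
      map_eq_zero] at h1
    rcases h1 with h1 | h1
    · exact hv0 (congrArg Subtype.val h1)
    · obtain ⟨s, -, hs⟩ := Finset.prod_eq_zero_iff.mp h1
      simp only [d, eval_sub, eval_mul, eval_C, eval_X] at hs
      exact ha _ (γ s).2 (by linear_combination hs)
  have hpt : aeval ratio p = 0 := by
    simp only [p, map_sub, map_mul, aeval_map_algebraMap, aeval_C, map_prod]
    rw [Finset.prod_congr rfl hdr, Finset.prod_mul_distrib, ← hvT]
    exact sub_self _
  have hpd : p.natDegree ≤ T.card := by
    have hle : ∀ f : K 1 → ℂ[X], (∀ s, (f s).natDegree ≤ 1) →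
        ((∏ s ∈ T, f s).map (algebraMap ℂ L)).natDegree ≤ T.card := by
      intro f hf
      refine natDegree_map_le.trans ((natDegree_prod_le _ _).trans ?_)
      exact (Finset.sum_le_sum fun s _ => hf s).trans (by simp)
    exact (natDegree_sub_le_of_le (hle r hr1)
      ((natDegree_C_mul_le v' _).trans (hle d hd1))).trans (max_self _).le
  have hLF : L ≤ ratioInvariants Γ := by
    rw [hL, IntermediateField.adjoin_le_iff, Set.singleton_subset_iff]
    exact hmem
  have hLt : IsIntegral L ratio := IsAlgebraic.isIntegral ⟨p, hp0, hpt⟩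
  have hFt : IsIntegral (ratioInvariants Γ) ratio := by
    have := Fintype.ofFinite Γ
    obtain ⟨q, hq⟩ : (∏ g : Γ, (X - C (gammaAut Γ g ratio))) ∈
        Polynomial.lifts (algebraMap (ratioInvariants Γ) (K 1)) := by
      rw [Polynomial.lifts_iff_coeff_lifts]
      exact fun m => ⟨⟨_, coeff_prod_orbit_ratio_mem Γ m⟩, rfl⟩
    have hq : q.map (algebraMap (ratioInvariants Γ) (K 1)) = _ := hq
    refine IsAlgebraic.isIntegral ⟨q, ?_, ?_⟩
    · rintro rfl
      rw [Polynomial.map_zero] at hq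
      exact (monic_prod_of_monic _ _ fun i _ => monic_X_sub_C _).ne_zero hq.symm
    · rw [aeval_def, ← eval_map, hq, eval_prod]
      exact Finset.prod_eq_zero (Finset.mem_univ 1) (by simp)
  refine eq_of_natDegree_minpoly_le hLF inf_le_left hLt ?_
  exact (natDegree_le_natDegree (minpoly.degree_le_of_ne_zero L ratio hp0 hpt)).trans
    (hpd.trans (card_orbit_le_natDegree Γ hFt))

/-! ### Existence of explicit pairs -/

/-- Each g excludes at most one `a`: g₁₂ = g₂₂ = 0 would contradict det g = 1. -/
theorem exists_generic (Γ : Subgroup SL2) [Finite Γ] :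
    ∃ a : ℂ, ∀ g ∈ Γ, g.1 1 1 ≠ a * g.1 0 1 := by
  have hfin : (⋃ g : Γ, {a : ℂ | (g : SL2) 1 1 = a * (g : SL2) 0 1}).Finite := by
    refine Set.finite_iUnion fun g => Set.Subsingleton.finite fun a ha b hb => ?_
    have hdet := Matrix.det_fin_two ((g : SL2) : Matrix (Fin 2) (Fin 2) ℂ)
    rw [Matrix.SpecialLinearGroup.det_coe] at hdet
    simp only [Set.mem_ofPred_eq] at ha hb
    have h0 : (g : SL2) 0 1 ≠ 0 := by
      intro h0
      rw [h0, mul_zero] at ha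
      rw [ha, h0] at hdet
      simp at hdet
    exact mul_right_cancel₀ h0 (ha.symm.trans hb)
  obtain ⟨a, ha⟩ := hfin.exists_notMem
  exact ⟨a, fun g hg h => ha (Set.mem_iUnion.mpr ⟨⟨g, hg⟩, h⟩)⟩

theorem IsEigenrow.isEigenform {Γ : Subgroup SL2} {r : Fin 2 → ℂ}
    (h : IsEigenrow (natRep Γ) r) : IsEigenform Γ (r 0 • x 0 + r 1 • y 0) := by
  refine ⟨⟨_, _, rfl⟩, fun g => ?_⟩
  obtain ⟨c, hc⟩ := h g⁻¹
  refine ⟨c, ?_⟩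
  have hm : natRep Γ g⁻¹ = Matrix.adjugate ((g : SL2) : Matrix (Fin 2) (Fin 2) ℂ) :=
    Matrix.SpecialLinearGroup.coe_inv (g : SL2)
  have h0 := congrFun hc 0
  have h1 := congrFun hc 1
  rw [hm, Matrix.adjugate_fin_two] at h0 h1
  simp only [Matrix.vecMul, dotProduct, Fin.sum_univ_two, Matrix.of_apply, Matrix.cons_val',
    Matrix.cons_val_zero, Matrix.cons_val_one, Matrix.cons_val_fin_one, Pi.smul_apply,
    smul_eq_mul] at h0 h1
  have e0 := congrArg (algebraMap ℂ (K 1)) h0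
  have e1 := congrArg (algebraMap ℂ (K 1)) h1
  simp only [map_add, map_mul, map_neg] at e0 e1
  simp only [Algebra.smul_def, map_add, map_mul, AlgEquiv.commutes, gammaAut_x, gammaAut_y]
  linear_combination x 0 * e0 + y 0 * e1

theorem exists_explicitPair (Γ : Subgroup SL2) [Finite Γ] : ∃ u v, ExplicitPair Γ u v := by
  by_cases h : (-1 : SL2) ∈ Γ
  · obtain ⟨a, ha⟩ := exists_generic Γ
    exact ⟨_, _, .even _ h (adjoin_orbitProduct Γ a ha)⟩
  · obtain ⟨r, s, hr, hs, hrs⟩ := exists_eigenrows Γ h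
    refine ⟨_, _, .cyclic _ _ hr.isEigenform hs.isEigenform ?_⟩
    rw [bracket_linearForm, hrs, map_one]

/-! ### The factors of `K n` -/

theorem factor_coord {n : ℕ} (i : Fin n) (k : Fin 1) (b : Fin 2) :
    factor i (coord (k, b)) = coord (i, b) := by
  unfold factor
  rw [coord, IsFractionRing.liftAlgHom_apply, IsFractionRing.lift_algebraMap]
  simp [factorP, coord]
  rfl

theorem bracket_map_eq_zero {m n : ℕ} (φ : K m →ₐ[ℂ] K n) (h : K n)
    (h0 : ∀ p, bracket h (φ (coord p)) = 0) (f : K m) : bracket h (φ f) = 0 := by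
  rw [← ham_apply]
  refine twisted_derivation_eq_zero φ ((ham h).toLinearMap ∘ₗ φ.toLinearMap) (fun a b => ?_)
    (fun p => ?_) f
  · change ham h (φ (a * b)) = φ a * ham h (φ b) + φ b * ham h (φ a)
    rw [map_mul, Derivation.leibniz, smul_eq_mul, smul_eq_mul]
  · change ham h (φ (coord p)) = 0
    rw [ham_apply, h0]

theorem bracket_coord_of_ne {n : ℕ} {i j : Fin n} (hij : i ≠ j) (b c : Fin 2) :
    bracket (coord (i, b)) (coord (j, c)) = 0 := by
  fin_cases c
  · simp [bracket_coord_zero, partialD_coord, hij]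
  · simp [bracket_coord_one, partialD_coord, hij]

theorem bracket_factor_of_ne {n : ℕ} {i j : Fin n} (hij : i ≠ j) (f g : K 1) :
    bracket (factor i f) (factor j g) = 0 := by
  apply bracket_map_eq_zero
  rintro ⟨k, b⟩
  rw [bracket_skew, neg_eq_zero]
  apply bracket_map_eq_zero
  rintro ⟨l, c⟩
  rw [factor_coord, factor_coord, bracket_coord_of_ne hij.symm]

theorem bracket_factor_self {n : ℕ} (i : Fin n) (f g : K 1) :
    bracket (factor i f) (factor i g) = factor i (bracket f g) := by
  symm
  apply map_bracket_of_coord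
  rintro ⟨k, b⟩ ⟨l, c⟩
  obtain rfl := Subsingleton.elim k l
  rw [factor_coord, factor_coord]
  fin_cases c
  · simp only [Fin.zero_eta, bracket_coord_zero, partialD_coord, Prod.mk.injEq, true_and]
    split_ifs <;> simp
  · simp only [Fin.mk_one, bracket_coord_one, partialD_coord, Prod.mk.injEq, true_and]
    split_ifs <;> simp

/-- For g = (γ, σ), the element `(g⁻¹.left i)⁻¹` is γ at the index σ i. -/
theorem wreathAut_factor (Γ : Subgroup SL2) (n : ℕ) (g : Wreath Γ n) (i : Fin n) (f : K 1) :
    wreathAut Γ n g (factor i f) = factor (g.right i) (gammaAut Γ (g⁻¹.left i)⁻¹ f) := by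
  have : (wreathAut Γ n g).toAlgHom.comp (factor i) =
      (factor (g.right i)).comp (gammaAut Γ (g⁻¹.left i)⁻¹).toAlgHom := by
    apply algHom_ext_coord
    rintro ⟨k, b⟩
    change wreathAut Γ n g (factor i (coord (k, b))) =
      factor (g.right i) (gammaAut Γ (g⁻¹.left i)⁻¹ (coord (k, b)))
    rw [factor_coord, wreathAut_coord_pair, gammaAut_coord, map_sum, Subgroup.coe_inv, inv_inv]
    refine Finset.sum_congr rfl fun c _ => ?_
    rw [Algebra.smul_def, Algebra.smul_def, map_mul, AlgHom.commutes, factor_coord]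
  exact DFunLike.congr_fun this f

theorem wreathAut_factor_of_mem {Γ : Subgroup SL2} {n : ℕ} (g : Wreath Γ n) (i : Fin n) {f : K 1}
    (hf : f ∈ KGamma Γ) : wreathAut Γ n g (factor i f) = factor (g.right i) f := by
  rw [wreathAut_factor, mem_KGamma.mp hf]

/-! ### Symmetric functions of the copies of `v` -/

theorem map_bigV {n : ℕ} {v : K 1} {B : Type*} [CommRing B] [Algebra ℂ B] {τ j : K n →ₐ[ℂ] B}
    {σ : Equiv.Perm (Fin n)} (hv : ∀ i, τ (factor i v) = j (factor (σ i) v)) (k : Fin n) :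
    τ (bigV n v k) = j (bigV n v k) := by
  have h : MvPolynomial.rename σ (elem n k) = elem n k := MvPolynomial.rename_esymm _ _ _ σ
  unfold bigV
  rw [MvPolynomial.comp_aeval_apply, MvPolynomial.comp_aeval_apply]
  conv_rhs => rw [← h, MvPolynomial.aeval_rename]
  congr 2
  exact funext hv

/-- The e_k are symmetric, so permuting the variables permutes the rows of M. -/
theorem map_jacobian {n : ℕ} {v : K 1} {B : Type*} [CommRing B] [Algebra ℂ B] {τ j : K n →ₐ[ℂ] B}
    {σ : Equiv.Perm (Fin n)} (hv : ∀ i, τ (factor i v) = j (factor (σ i) v)) (i k : Fin n) :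
    τ (jacobian n v i k) = j (jacobian n v (σ i) k) := by
  have h : MvPolynomial.rename σ (elem n k) = elem n k := MvPolynomial.rename_esymm _ _ _ σ
  unfold jacobian
  rw [Matrix.of_apply, Matrix.of_apply, MvPolynomial.comp_aeval_apply,
    MvPolynomial.comp_aeval_apply]
  conv_rhs => rw [← h, MvPolynomial.pderiv_rename σ.injective, MvPolynomial.aeval_rename]
  congr 2
  exact funext hv

open Polynomial in
theorem coeff_prod_factor_mem (n : ℕ) (v : K 1) (m : ℕ) :
    (∏ i, (X - C (factor i v))).coeff m ∈
      IntermediateField.adjoin ℂ (Set.range (bigV n v)) := by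
  set s : Multiset (K n) := Finset.univ.val.map fun i => factor i v with hs
  have hcard : s.card = n := by simp [hs]
  have hprod : (∏ i, (X - C (factor i v))) = (s.map fun t => X - C t).prod := by
    rw [hs, Multiset.map_map]
    rfl
  rcases Nat.lt_or_ge n m with hm | hm
  · rw [coeff_eq_zero_of_natDegree_lt]
    · exact zero_mem _
    · rwa [natDegree_prod_of_monic _ _ fun i _ => monic_X_sub_C _, Finset.sum_congr rfl
        fun i _ => natDegree_X_sub_C _, Finset.sum_const, Finset.card_univ, Fintype.card_fin,
        smul_eq_mul, mul_one]
  · rw [hprod, Multiset.prod_X_sub_C_coeff s (hcard.symm ▸ hm), hcard]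
    refine mul_mem (pow_mem (neg_mem (one_mem _)) _) ?_
    rw [hs, ← MvPolynomial.aeval_esymm_eq_multiset_esymm (Fin n) ℂ]
    -- Up to sign the coefficient is e_{n-m}: it is 1 for m = n, and otherwise `bigV` at n - m - 1,
    -- as `elem` is indexed from e₁.
    rcases Nat.eq_zero_or_pos (n - m) with h0 | h0
    · rw [h0, MvPolynomial.esymm_zero, map_one]
      exact one_mem _
    · apply IntermediateField.subset_adjoin
      refine ⟨⟨n - m - 1, by omega⟩, ?_⟩
      unfold bigV elem
      congr 2
      simp only
      omega

/-! ### The Jacobian matrix of a pair with bracket one -/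

section Pair

variable {n : ℕ} {u v : K 1}

theorem bracket_factor_pair (h : bracket u v = 1) (i j : Fin n) :
    bracket (factor i u) (factor j v) = if i = j then 1 else 0 := by
  split_ifs with hij
  · rw [hij, bracket_factor_self, h, map_one]
  · exact bracket_factor_of_ne hij u v

theorem bracket_factor_same (f : K 1) (i j : Fin n) :
    bracket (factor i f) (factor j f) = 0 := by
  have h0 : bracket f f = 0 := PoissonAlgebra.pb_self (R := ℂ) f
  by_cases hij : i = j
  · rw [hij, bracket_factor_self, h0, map_zero]
  · exact bracket_factor_of_ne hij f f

theorem factor_injective_of_pair (h : bracket u v = 1) :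
    Function.Injective fun i : Fin n => factor i v := by
  intro i j hij
  have h1 := bracket_factor_pair h i i
  have h2 := bracket_factor_pair h i j
  rw [if_pos rfl] at h1
  by_contra hne
  rw [if_neg hne, ← show factor i v = factor j v from hij, h1] at h2
  exact one_ne_zero h2

theorem bracket_factor_bigV (h : bracket u v = 1) (i j : Fin n) :
    bracket (factor i u) (bigV n v j) = jacobian n v i j := by
  rw [bigV, ham_aeval, Finset.sum_eq_single i]
  · rw [bracket_factor_pair h, if_pos rfl, mul_one]
    rfl
  · intro k _ hk
    rw [bracket_factor_pair h, if_neg hk.symm, mul_zero]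
  · simp

/-- If c M = 0, the derivation ∑ c_k {u_k, ·} kills all V_j, hence all v_i, which are algebraic over
ℂ(V). Its value at v_i is c_i. -/
theorem det_jacobian_ne_zero (h : bracket u v = 1) : (jacobian n v).det ≠ 0 := by
  intro hdet
  obtain ⟨c, hc0, hc⟩ := Matrix.exists_vecMul_eq_zero_iff.mpr hdet
  let D : Derivation ℂ (K n) (K n) := ∑ k, c k • ham (factor k u)
  have hD : ∀ f, D f = ∑ k, c k * bracket (factor k u) f := by
    intro f
    simp only [D, ← ham_apply]
    rw [← Derivation.coeFnAddMonoidHom_apply, map_sum, Finset.sum_apply]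
    rfl
  have hV : IntermediateField.adjoin ℂ (Set.range (bigV n v)) ≤ derivKer D := by
    rw [IntermediateField.adjoin_le_iff]
    rintro _ ⟨j, rfl⟩
    change D _ = 0
    rw [hD]
    simp only [bracket_factor_bigV h]
    exact congrFun hc j
  apply hc0
  ext i
  have h1 := derivation_eq_zero_of_prod (D := D) (fun i : Fin n => factor i v)
    (fun m => hV (coeff_prod_factor_mem n v m)) i
  rw [hD, Finset.sum_eq_single i] at h1
  · rwa [bracket_factor_pair h, if_pos rfl, mul_one] at h1
  · intro k _ hk
    rw [bracket_factor_pair h, if_neg hk, mul_zero]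
  · simp

theorem jacobian_mulVec_bigU (h : bracket u v = 1) :
    (jacobian n v).mulVec (bigU n u v) = fun i => factor i u := by
  have : bigU n u v = (jacobian n v)⁻¹.mulVec fun i => factor i u := rfl
  rw [this, Matrix.mulVec_mulVec, Matrix.mul_nonsing_inv _ (det_jacobian_ne_zero h).isUnit,
    Matrix.one_mulVec]

theorem factor_eq_sum (h : bracket u v = 1) (i : Fin n) :
    factor i u = ∑ k, jacobian n v i k * bigU n u v k :=
  (congrFun (jacobian_mulVec_bigU h) i).symm

/-- U is the only solution of M U = u, and `τ` merely permutes the equations of this system. -/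
theorem map_bigU (h : bracket u v = 1) {B : Type*} [Field B] [Algebra ℂ B] {τ j : K n →ₐ[ℂ] B}
    {σ : Equiv.Perm (Fin n)} (hu : ∀ i, τ (factor i u) = j (factor (σ i) u))
    (hv : ∀ i, τ (factor i v) = j (factor (σ i) v)) (k : Fin n) :
    τ (bigU n u v k) = j (bigU n u v k) := by
  have hdet : IsUnit ((jacobian n v).map j).det := by
    have := (RingHom.map_det (j : K n →+* B) (jacobian n v)).symm
    change ((jacobian n v).map j).det = _ at this
    rw [this]
    exact ((det_jacobian_ne_zero h).isUnit).map (j : K n →+* B)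
  have hinj := Matrix.mulVec_injective_iff_isUnit.mpr
    ((Matrix.isUnit_iff_isUnit_det _).mpr hdet)
  refine congrFun (hinj (a₁ := fun k => τ (bigU n u v k)) (a₂ := fun k => j (bigU n u v k)) ?_) k
  ext i
  simp only [Matrix.mulVec, dotProduct, Matrix.map_apply]
  have h1 := congrArg τ (factor_eq_sum (n := n) h (σ.symm i))
  have h2 := congrArg j (factor_eq_sum (n := n) h i)
  rw [hu, σ.apply_symm_apply, h2, map_sum, map_sum] at h1
  simp only [map_mul, map_jacobian hv, σ.apply_symm_apply] at h1
  exact h1.symm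

/-! ### The brackets of the generators -/

/-- The field generated by the copies of `v`. -/
def vField (n : ℕ) (v : K 1) : IntermediateField ℂ (K n) :=
  IntermediateField.adjoin ℂ (Set.range fun i => factor i v)

theorem bracket_vField_left {f g : K n} (h : ∀ i, bracket (factor i v) g = 0)
    (hf : f ∈ vField n v) : bracket f g = 0 := by
  have hle : vField n v ≤ derivKer (ham g) := by
    rw [vField, IntermediateField.adjoin_le_iff]
    rintro _ ⟨i, rfl⟩
    change ham g (factor i v) = 0
    rw [ham_apply, bracket_skew, h, neg_zero]
  rw [bracket_skew, ← ham_apply, hle hf, neg_zero]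

theorem bracket_vField {f g : K n} (hf : f ∈ vField n v) (hg : g ∈ vField n v) :
    bracket f g = 0 := by
  refine bracket_vField_left (fun i => ?_) hf
  rw [bracket_skew, bracket_vField_left (fun j => bracket_factor_same v j i) hg, neg_zero]

theorem aeval_mem_vField (q : MvPolynomial (Fin n) ℂ) :
    MvPolynomial.aeval (fun i => factor i v) q ∈ vField n v := by
  have h : ∀ i, factor i v ∈ vField n v := fun i =>
    IntermediateField.subset_adjoin _ _ ⟨i, rfl⟩
  have : MvPolynomial.aeval (fun i => factor i v) q =
      ((MvPolynomial.aeval fun i => (⟨factor i v, h i⟩ : vField n v)) q : vField n v) := by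
    change _ = (vField n v).val _
    rw [MvPolynomial.comp_aeval_apply]
    rfl
  rw [this]
  exact Subtype.property _

theorem bigV_mem_vField (j : Fin n) : bigV n v j ∈ vField n v := aeval_mem_vField _

theorem factor_mem_vField (i : Fin n) : factor i v ∈ vField n v :=
  IntermediateField.subset_adjoin _ _ ⟨i, rfl⟩

theorem inv_apply_mem {k E ι : Type*} [Field k] [Field E] [Algebra k E] [Fintype ι]
    [DecidableEq ι] (F : IntermediateField k E) {A : Matrix ι ι E} (hA : ∀ i j, A i j ∈ F)
    (hdet : A.det ≠ 0) (i j : ι) : A⁻¹ i j ∈ F := by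
  let A' : Matrix ι ι F := Matrix.of fun i j => ⟨A i j, hA i j⟩
  have hAA : (algebraMap F E).mapMatrix A' = A := rfl
  have hdet' : IsUnit A'.det := by
    rw [isUnit_iff_ne_zero]
    intro h0
    apply hdet
    rw [← hAA, ← RingHom.map_det, h0, map_zero]
  have h1 : A * (algebraMap F E).mapMatrix A'⁻¹ = 1 := by
    conv_lhs => rw [← hAA]
    rw [← map_mul, Matrix.mul_nonsing_inv _ hdet', map_one]
  rw [Matrix.inv_eq_right_inv h1]
  exact (A'⁻¹ i j).2

theorem jacobian_inv_mem (h : bracket u v = 1) (i j : Fin n) :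
    (jacobian n v)⁻¹ i j ∈ vField n v :=
  inv_apply_mem _ (fun _ _ => aeval_mem_vField _) (det_jacobian_ne_zero h) i j

theorem bracket_factor_mem_vField (h : bracket u v = 1) (i : Fin n) {f : K n}
    (hf : f ∈ vField n v) : bracket (factor i u) f ∈ vField n v := by
  rw [← ham_apply]
  refine derivation_mem_adjoin ?_ hf
  rintro _ ⟨j, rfl⟩
  rw [ham_apply, bracket_factor_pair h]
  split_ifs
  · exact one_mem _
  · exact zero_mem _

theorem bracket_bigU (f : K n) (j : Fin n) : bracket f (bigU n u v j) =
    ∑ l, ((jacobian n v)⁻¹ j l * bracket f (factor l u) +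
      factor l u * bracket f ((jacobian n v)⁻¹ j l)) := by
  rw [bigU, ← ham_apply, map_sum]
  simp only [Derivation.leibniz, ham_apply, smul_eq_mul]

theorem bracket_bigV_bigV (i j : Fin n) : bracket (bigV n v i) (bigV n v j) = 0 :=
  bracket_vField (bigV_mem_vField i) (bigV_mem_vField j)

theorem bracket_bigU_bigV (h : bracket u v = 1) (i j : Fin n) :
    bracket (bigU n u v i) (bigV n v j) = if i = j then 1 else 0 := by
  have h1 := Matrix.nonsing_inv_mul _ (det_jacobian_ne_zero (n := n) h).isUnit
  have h2 := congrFun (congrFun h1 i) j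
  rw [Matrix.mul_apply, Matrix.one_apply] at h2
  rw [bracket_skew, bracket_bigU, ← Finset.sum_neg_distrib, ← h2]
  refine Finset.sum_congr rfl fun l _ => ?_
  rw [bracket_vField (bigV_mem_vField j) (jacobian_inv_mem h i l), bracket_skew,
    bracket_factor_bigV h]
  ring

/-- W = {U_i, U_j} is a combination of the u_l with coefficients c_l ∈ ℂ(v₁, …, v_n). By Jacobi W
commutes with every V_k, since the {U_i, V_k} are constants. Hence W commutes with the v_k, and {W,
v_k} = c_k. -/
theorem bracket_bigU_bigU (h : bracket u v = 1) (i j : Fin n) :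
    bracket (bigU n u v i) (bigU n u v j) = 0 := by
  set N := (jacobian n v)⁻¹ with hN
  have hNm : ∀ a b, N a b ∈ vField n v := jacobian_inv_mem h
  let c : Fin n → K n := fun l => ∑ k, (-(N j k * bracket (factor k u) (N i l)) +
    N i k * bracket (factor k u) (N j l))
  have hcm : ∀ l, c l ∈ vField n v := fun l => sum_mem fun k _ =>
    add_mem (neg_mem (mul_mem (hNm _ _) (bracket_factor_mem_vField h k (hNm _ _))))
      (mul_mem (hNm _ _) (bracket_factor_mem_vField h k (hNm _ _)))
  have e1 : ∀ l, bracket (bigU n u v i) (factor l u) =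
      ∑ k, -(factor k u * bracket (factor l u) (N i k)) := by
    intro l
    rw [bracket_skew, bracket_bigU, ← Finset.sum_neg_distrib]
    refine Finset.sum_congr rfl fun k _ => ?_
    rw [bracket_factor_same, mul_zero, zero_add]
  have e2 : ∀ l, bracket (bigU n u v i) (N j l) =
      ∑ k, N i k * bracket (factor k u) (N j l) := by
    intro l
    rw [bracket_skew, bracket_bigU, ← Finset.sum_neg_distrib]
    refine Finset.sum_congr rfl fun k _ => ?_
    rw [← hN, bracket_vField (hNm j l) (hNm i k), mul_zero, add_zero, bracket_skew (N j l), mul_neg,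
      neg_neg]
  have hW : bracket (bigU n u v i) (bigU n u v j) = ∑ l, c l * factor l u := by
    rw [bracket_bigU, Finset.sum_add_distrib]
    simp only [← hN, e1, e2, c, Finset.sum_add_distrib, add_mul, Finset.sum_mul, Finset.mul_sum]
    congr 1
    · rw [Finset.sum_comm]
      exact Finset.sum_congr rfl fun k _ => Finset.sum_congr rfl fun l _ => by ring
    · exact Finset.sum_congr rfl fun k _ => Finset.sum_congr rfl fun l _ => by ring
  have hV : IntermediateField.adjoin ℂ (Set.range (bigV n v)) ≤
      derivKer (ham (bracket (bigU n u v i) (bigU n u v j))) := by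
    rw [IntermediateField.adjoin_le_iff]
    rintro _ ⟨k, rfl⟩
    change ham _ _ = 0
    have hd : ∀ (f : K n) (a b : Fin n), bracket f (if a = b then 1 else 0) = 0 := by
      intro f a b
      rw [← ham_apply]
      split_ifs <;> simp
    rw [← ham_bracket, Derivation.commutator_apply]
    simp only [ham_apply, bracket_bigU_bigV h, hd, sub_zero]
  have hc : ∀ k, c k = 0 := by
    intro k
    have h1 := derivation_eq_zero_of_prod (D := ham (bracket (bigU n u v i) (bigU n u v j)))
      (fun i : Fin n => factor i v) (fun m => hV (coeff_prod_factor_mem n v m)) k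
    rw [ham_apply, bracket_skew, neg_eq_zero, hW, ← ham_apply, map_sum] at h1
    simp only [Derivation.leibniz, ham_apply, smul_eq_mul,
      bracket_vField (factor_mem_vField k) (hcm _), mul_zero, add_zero] at h1
    rw [Finset.sum_eq_single k] at h1
    · rw [bracket_skew, bracket_factor_pair h, if_pos rfl, mul_neg, mul_one, neg_eq_zero] at h1
      exact h1
    · intro l _ hl
      rw [bracket_skew, bracket_factor_pair h, if_neg hl, neg_zero, mul_zero]
    · simp
  rw [hW]
  exact Finset.sum_eq_zero fun l _ => by rw [hc, zero_mul]

theorem isCanonical_bigU_bigV (h : bracket u v = 1) :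
    IsCanonical fun p : Fin n × Fin 2 => (![bigU n u v p.1, bigV n v p.1] : Fin 2 → K n) p.2 := by
  rintro ⟨i, b⟩ ⟨j, c⟩
  fin_cases b <;> fin_cases c
  · simp [bracket_bigU_bigU h, bracket_coord_zero, partialD_coord]
  · simp [bracket_bigU_bigV h, bracket_coord_one, partialD_coord]
  · simp only [Fin.mk_one, Matrix.cons_val_one, Fin.zero_eta, Matrix.cons_val_zero,
      bracket_coord_zero, partialD_coord]
    rw [bracket_skew]
    simp [bracket_bigU_bigV h, eq_comm]
  · simp [bracket_bigV_bigV, bracket_coord_one, partialD_coord]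

end Pair

/-! ### Invariants of the wreath product -/

/-- The coefficients of ∏ (X - v_i) lie in ℂ(V), so `τ` and `j` give the same roots. The v_i are
distinct, so the matching of roots is a permutation. -/
theorem exists_perm_of_map_bigV {n : ℕ} {u v : K 1} (h : bracket u v = 1) {Ω : Type*} [Field Ω]
    [Algebra ℂ Ω] {τ j : K n →ₐ[ℂ] Ω} (hV : ∀ i, τ (bigV n v i) = j (bigV n v i)) :
    ∃ σ : Equiv.Perm (Fin n), ∀ i, τ (factor i v) = j (factor (σ i) v) := by
  have key := exists_map_eq_of_prod_map_eq (τ : K n →+* Ω) (j : K n →+* Ω)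
    (fun i : Fin n => factor i v) (by
      ext m
      rw [Polynomial.coeff_map, Polynomial.coeff_map]
      refine eqOn_adjoin ?_ (coeff_prod_factor_mem n v m)
      rintro _ ⟨i, rfl⟩
      exact hV i)
  choose σ hσ using key
  have hinj : Function.Injective σ := by
    intro a b hab
    apply factor_injective_of_pair (n := n) h
    apply (τ : K n →+* Ω).injective
    rw [hσ a, hσ b, hab]
  exact ⟨Equiv.ofBijective σ (Finite.injective_iff_bijective.mp hinj), hσ⟩

theorem exists_wreathAut_of_map_eq {Γ : Subgroup SL2} [Finite Γ] {n : ℕ} {u v : K 1}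
    (h : IsCanonicalPair Γ u v) {Ω : Type*} [Field Ω] [Algebra ℂ Ω] {τ j : K n →ₐ[ℂ] Ω}
    (hU : ∀ i, τ (bigU n u v i) = j (bigU n u v i))
    (hV : ∀ i, τ (bigV n v i) = j (bigV n v i)) :
    ∃ g, ∀ p, τ (coord p) = j (wreathAut Γ n g (coord p)) := by
  obtain ⟨σ, hσ⟩ := exists_perm_of_map_bigV h.bracket_eq hV
  have hu : ∀ i, τ (factor i u) = j (factor (σ i) u) := by
    intro i
    rw [factor_eq_sum h.bracket_eq, factor_eq_sum h.bracket_eq, map_sum, map_sum]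
    exact Finset.sum_congr rfl fun k _ => by rw [map_mul, map_mul, hU, map_jacobian hσ]
  have key : ∀ i, ∃ g : Γ, ∀ f, τ (factor i f) = j (factor (σ i) (gammaAut Γ g f)) := fun i =>
    exists_gammaAut_of_eqOn Γ (τ.comp (factor i)) (j.comp (factor (σ i)))
      (h.eqOn (hu i) (hσ i))
  choose γ hγ using key
  -- The shift by σ⁻¹ makes g act by γ i on the functions of factor i, which it moves to factor σ i.
  let g : Wreath Γ n := ⟨fun k => γ (σ.symm k), σ⟩
  have hg : ∀ i, (g⁻¹.left i)⁻¹ = γ i := by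
    intro i
    have : g⁻¹.left i = (γ (σ.symm (σ i)))⁻¹ := rfl
    rw [this, inv_inv, σ.symm_apply_apply]
  refine ⟨g, ?_⟩
  rintro ⟨i, b⟩
  rw [← factor_coord i 0 b, wreathAut_factor, hg, hγ]

theorem exists_wreath_equiv {Γ : Subgroup SL2} [Finite Γ] (n : ℕ) {u v : K 1}
    (h : IsCanonicalPair Γ u v) : ∃ e : PoissonEquiv ℂ (KWreath Γ n) (K n), ∀ i : Fin n,
      ((e.toAlgEquiv.symm (x i) : KWreath Γ n) : K n) = bigU n u v i ∧
      ((e.toAlgEquiv.symm (y i) : KWreath Γ n) : K n) = bigV n v i := by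
  have hc := isCanonical_bigU_bigV (n := n) h.bracket_eq
  obtain ⟨hu, hv⟩ := h.mem
  obtain ⟨e, he⟩ := hc.exists_equiv (wreathAut Γ n).range
    (by rintro _ ⟨g, rfl⟩; exact wreathAut_isPoissonAut Γ n g)
    (hc.adjoin_eq_fixedField _ (by
      rintro ⟨i, b⟩
      rw [IntermediateField.mem_fixedField_iff]
      rintro _ ⟨g, rfl⟩
      fin_cases b
      · exact map_bigU h.bracket_eq (τ := (wreathAut Γ n g).toAlgHom) (j := AlgHom.id ℂ (K n))
          (fun k => wreathAut_factor_of_mem g k hu) (fun k => wreathAut_factor_of_mem g k hv) i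
      · exact map_bigV (τ := (wreathAut Γ n g).toAlgHom) (j := AlgHom.id ℂ (K n))
          (fun k => wreathAut_factor_of_mem g k hv) i) (by
      intro τ hτ
      obtain ⟨g, hg⟩ := exists_wreathAut_of_map_eq h (τ := τ) (j := incl n)
        (fun i => hτ (i, 0)) (fun i => hτ (i, 1))
      exact ⟨_, ⟨g, rfl⟩, hg⟩))
  exact ⟨e, fun i => ⟨he (i, 0), he (i, 1)⟩⟩

end PoissonNoether

end

open PoissonNoether in
theorem mainTheorem3 (Γ : Subgroup SL2) [Finite Γ] (n : ℕ) :
    (∀ a : ℂ, (∀ g ∈ Γ, g.1 1 1 ≠ a * g.1 0 1) →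
      IntermediateField.adjoin ℂ {orbitProduct Γ a} = ratioInvariants Γ) ∧
    (∃ u v : K 1, ExplicitPair Γ u v) ∧
    (∀ u v : K 1, ExplicitPair Γ u v → IsCanonicalPair Γ u v) ∧
    ∀ u v : K 1, IsCanonicalPair Γ u v →
      (jacobian n v).det ≠ 0 ∧
      ∃ e : PoissonEquiv ℂ (KWreath Γ n) (K n), ∀ i : Fin n,
        ((e.toAlgEquiv.symm (x i) : KWreath Γ n) : K n) = bigU n u v i ∧
        ((e.toAlgEquiv.symm (y i) : KWreath Γ n) : K n) = bigV n v i := by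
  exact ⟨fun a ha => adjoin_orbitProduct Γ a ha, exists_explicitPair Γ,
    fun _ _ h => h.isCanonicalPair,
    fun _ _ h => ⟨det_jacobian_ne_zero h.bracket_eq, exists_wreath_equiv n h⟩⟩
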